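/- Let $\mathfrak g=\mathfrak{sl}(2,\mathbb C)$ with standard basis $\mathbf e,\mathbf h,\mathbf f$, and let $\mathbb F=\mathbb C[x,y,\zeta^{\pm1}]$ be the commutative algebra of regular functions on the big Bruhat cell $$G_0=\left\{\begin{pmatrix}1&x\\0&1\end{pmatrix}\begin{pmatrix}0&-1\\1&0\end{pmatrix}\begin{pmatrix}\zeta&0\\0&\zeta^{-1}\end{pmatrix}\begin{pmatrix}1&y\\0&1\end{pmatrix}\;:\;x,y\in\mathbb C,\ \zeta\in\mathbb C^\times\right\}\subset SL(2,\mathbb C).$$ The left and right infinitesimal regular actions of $\mathfrak g$ on $\mathbb F$ are the commuting actions by derivations $$\pi_l(\mathbf e)=-\partial_x,\quad \pi_l(\mathbf h)=\zeta\partial_\zeta-2x\partial_x,\quad \pi_l(\mathbf f)=-x\zeta\partial_\zeta+x^2\partial_x+\zeta^{-2}\partial_y,$$ $$\pi_r(\mathbf e)=\partial_y,\quad \pi_r(\mathbf h)=\zeta\partial_\zeta-2y\partial_y,\quad \pi_r(\mathbf f)=y\zeta\partial_\zeta-y^2\partial_y-\zeta^{-2}\partial_x,$$ and $\mathfrak g$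 acts on $\mathbb F$ diagonally, by $\pi_l+\pi_r$. For a commutative algebra $A$ on which $\mathfrak g$ acts by derivations through $\pi_A$, let $H^\bullet(\mathfrak g;A)$ be the cohomology of $\bigwedge^\bullet\mathfrak g'\otimes A$ with differential $$\mathbf d=\sum_i\varepsilon(g_i')\pi_A(g_i)-\tfrac12\sum_{i,j}\varepsilon(g_i')\varepsilon(g_j')\iota([g_i,g_j])$$ ($\{g_i\}$ a basis of $\mathfrak g$, $\{g_i'\}$ the dual basis of the dual space $\mathfrak g'$, $\varepsilon$ exterior multiplication, $\iota$ contraction), with the multiplication induced from $\bigwedge\mathfrak g'$ and $A$. Let $\mathbf P\cong\mathbb Z$ be the weight lattice and let the Weyl group $W\cong\mathbb Z/2$ act on the group algebra $\mathbb C[\mathbf P]$ through $\lambda\mapsto-\lambda$. **Theorem.** There is an isomorphism of graded commutative superalgebras over $\mathbb C$ $$H^\bullet(\mathfrak g;\mathbb F)\;\cong\;\mathbb C[\mathbf P]^W\otimes\textstyle\bigwedge^\bullet\mathbb C^2,$$ where $\mathbb C[\mathbf P]^W$ is placed in degree $0$ and $\mathbb C^2$ in degree $1$. In contrast to the case of finite-dimensional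 coefficient modules, $H^\bullet(\mathfrak g;\mathbb F)$ is not isomorphic, even as a graded vector space, to $\mathbb F^{\mathfrak g}\otimes H^\bullet(\mathfrak g;\mathbb C)$, where $\mathfrak g$ acts trivially on $\mathbb C$ (here $H^\bullet(\mathfrak g;\mathbb C)\cong H^\bullet_{DR}(SL(2,\mathbb C))$ is the de Rham cohomology of the group). -/

import Mathlib

open scoped TensorProduct LaurentPolynomial

noncomputable section

/-! ## Lie algebra cohomology with coefficients in a commutative algebra -/

namespace LieCohomology

section Complex

variable {g A ι : Type} [LieRing g] [LieAlgebra ℂ g] [CommRing A] [Algebra ℂ A] [Fintype ι]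

/-- The cochains `⋀ g' ⊗ A`.  As `A` is purely even, the ordinary multiplication of the tensor
product is the multiplication of the tensor product of superalgebras. -/
abbrev Cochains (g A : Type) [LieRing g] [LieAlgebra ℂ g] [CommRing A] [Algebra ℂ A] : Type :=
  ExteriorAlgebra ℂ (Module.Dual ℂ g) ⊗[ℂ] A

/-- The operator `ε(φ)` of exterior multiplication by `φ ∈ g'` on `⋀ g'`. -/
def wedge (φ : Module.Dual ℂ g) :
    ExteriorAlgebra ℂ (Module.Dual ℂ g) →ₗ[ℂ] ExteriorAlgebra ℂ (Module.Dual ℂ g) :=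
  LinearMap.mulLeft ℂ (ExteriorAlgebra.ι ℂ φ)

/-- The operator `ι(x)` of contraction with `x ∈ g` on `⋀ g'`: it kills `1` and satisfies
`{ι(x), ε(φ)} = φ(x)`. -/
def contract (x : g) :
    ExteriorAlgebra ℂ (Module.Dual ℂ g) →ₗ[ℂ] ExteriorAlgebra ℂ (Module.Dual ℂ g) :=
  CliffordAlgebra.contractLeft (Q := (0 : QuadraticForm ℂ (Module.Dual ℂ g)))
    (Module.Dual.eval ℂ g x)

/-- The differential
`d = ∑ i, ε(g'ᵢ) π(gᵢ) - 1/2 ∑ i j, ε(g'ᵢ) ε(g'ⱼ) ι([gᵢ, gⱼ])`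
for a basis `gᵢ` of `g` with dual basis `g'ᵢ`, where `g` acts on the commutative algebra `A` by
derivations through the Lie algebra homomorphism `π`. -/
def differential (b : Module.Basis ι ℂ g) (π : g →ₗ⁅ℂ⁆ Derivation ℂ A A) :
    Cochains g A →ₗ[ℂ] Cochains g A :=
  ∑ i, TensorProduct.map (wedge (b.coord i)) (π (b i) : A →ₗ[ℂ] A) -
    (1 / 2 : ℂ) • ∑ i, ∑ j,
      TensorProduct.map (wedge (b.coord i) ∘ₗ wedge (b.coord j) ∘ₗ contract ⁅b i, b j⁆)
        (LinearMap.id : A →ₗ[ℂ] A)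

/-- The parity automorphism `(-1)^deg` of the cochains. -/
def parity (g A : Type) [LieRing g] [LieAlgebra ℂ g] [CommRing A] [Algebra ℂ A] :
    Cochains g A →ₐ[ℂ] Cochains g A :=
  Algebra.TensorProduct.map
    (CliffordAlgebra.involute (Q := (0 : QuadraticForm ℂ (Module.Dual ℂ g)))) (AlgHom.id ℂ A)

theorem involute_iota (φ : Module.Dual ℂ g) :
    CliffordAlgebra.involute (Q := (0 : QuadraticForm ℂ (Module.Dual ℂ g)))
      (ExteriorAlgebra.ι ℂ φ) = -ExteriorAlgebra.ι ℂ φ :=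
  CliffordAlgebra.involute_ι φ

theorem wedge_apply (φ : Module.Dual ℂ g) (u : ExteriorAlgebra ℂ (Module.Dual ℂ g)) :
    wedge φ u = ExteriorAlgebra.ι ℂ φ * u := rfl

theorem contract_one (x : g) : contract x 1 = 0 :=
  CliffordAlgebra.contractLeft_one (Q := (0 : QuadraticForm ℂ (Module.Dual ℂ g))) _

theorem contract_iota_mul (x : g) (φ : Module.Dual ℂ g)
    (u : ExteriorAlgebra ℂ (Module.Dual ℂ g)) :
    contract x (ExteriorAlgebra.ι ℂ φ * u) = φ x • u - ExteriorAlgebra.ι ℂ φ * contract x u :=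
  CliffordAlgebra.contractLeft_ι_mul _ _ _

theorem iota_mul (φ : Module.Dual ℂ g) (u : ExteriorAlgebra ℂ (Module.Dual ℂ g)) :
    ExteriorAlgebra.ι ℂ φ * u =
      CliffordAlgebra.involute (Q := (0 : QuadraticForm ℂ (Module.Dual ℂ g))) u *
        ExteriorAlgebra.ι ℂ φ := by
  induction u using ExteriorAlgebra.induction with
  | algebraMap r => rw [AlgHom.commutes, Algebra.commutes]
  | ι ψ =>
    rw [involute_iota, neg_mul, eq_neg_iff_add_eq_zero]
    exact ExteriorAlgebra.ι_add_mul_swap φ ψ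
  | mul a b ha hb => rw [map_mul, ← mul_assoc, ha, mul_assoc, hb, mul_assoc]
  | add a b ha hb => rw [map_add, mul_add, add_mul, ha, hb]

theorem contract_mul (x : g) (u v : ExteriorAlgebra ℂ (Module.Dual ℂ g)) :
    contract x (u * v) = contract x u * v +
      CliffordAlgebra.involute (Q := (0 : QuadraticForm ℂ (Module.Dual ℂ g))) u *
        contract x v := by
  induction u using CliffordAlgebra.left_induction with
  | algebraMap r =>
    rw [AlgHom.commutes, ← Algebra.smul_def, map_smul, Algebra.algebraMap_eq_smul_one, map_smul]
    erw [contract_one]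
    simp
  | add a b ha hb => simp only [add_mul, map_add, ha, hb]; abel
  | ι_mul a φ ha =>
    have h1 := contract_iota_mul x φ (a * v)
    have h2 := contract_iota_mul x φ a
    have h3 := involute_iota φ
    change contract x (ExteriorAlgebra.ι ℂ φ * a * v) =
      contract x (ExteriorAlgebra.ι ℂ φ * a) * v +
      CliffordAlgebra.involute (Q := (0 : QuadraticForm ℂ (Module.Dual ℂ g)))
        (ExteriorAlgebra.ι ℂ φ * a) * contract x v
    rw [mul_assoc, h1, h2, map_mul CliffordAlgebra.involute, h3, ha]
    simp only [sub_mul, mul_add, neg_mul, mul_assoc, smul_mul_assoc]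
    abel

theorem parity_contract (x : g) (u : ExteriorAlgebra ℂ (Module.Dual ℂ g)) :
    contract x (CliffordAlgebra.involute (Q := (0 : QuadraticForm ℂ (Module.Dual ℂ g))) u) =
      -CliffordAlgebra.involute (Q := (0 : QuadraticForm ℂ (Module.Dual ℂ g)))
        (contract x u) := by
  induction u using CliffordAlgebra.left_induction with
  | algebraMap r =>
    rw [AlgHom.commutes, Algebra.algebraMap_eq_smul_one, map_smul]
    erw [contract_one]
    simp
  | add a b ha hb => simp only [map_add, ha, hb]; abel
  | ι_mul a φ ha =>
    have h3 := involute_iota φ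
    change contract x (CliffordAlgebra.involute (Q := (0 : QuadraticForm ℂ (Module.Dual ℂ g)))
        (ExteriorAlgebra.ι ℂ φ * a)) =
      -CliffordAlgebra.involute (Q := (0 : QuadraticForm ℂ (Module.Dual ℂ g)))
        (contract x (ExteriorAlgebra.ι ℂ φ * a))
    rw [map_mul CliffordAlgebra.involute, h3, contract_iota_mul, map_sub, map_smul,
      map_mul CliffordAlgebra.involute, h3, neg_mul, map_neg, contract_iota_mul, ha]
    simp

/-- The differential is an odd derivation. -/
theorem differential_mul (b : Module.Basis ι ℂ g) (π : g →ₗ⁅ℂ⁆ Derivation ℂ A A)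
    (u v : Cochains g A) :
    differential b π (u * v) = differential b π u * v + parity g A u * differential b π v := by
  induction u using TensorProduct.induction_on with
  | zero => simp
  | add u₁ u₂ h₁ h₂ => simp only [add_mul, map_add, h₁, h₂]; abel
  | tmul ω a =>
  induction v using TensorProduct.induction_on with
  | zero => simp
  | add v₁ v₂ h₁ h₂ => simp only [mul_add, map_add, h₁, h₂]; abel
  | tmul η c =>
  have e1 : ∀ i, TensorProduct.map (wedge (b.coord i)) (π (b i) : A →ₗ[ℂ] A)
        ((ω * η) ⊗ₜ[ℂ] (a * c)) =
      TensorProduct.map (wedge (b.coord i)) (π (b i) : A →ₗ[ℂ] A) (ω ⊗ₜ[ℂ] a) * (η ⊗ₜ[ℂ] c) +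
      parity g A (ω ⊗ₜ[ℂ] a) *
        TensorProduct.map (wedge (b.coord i)) (π (b i) : A →ₗ[ℂ] A) (η ⊗ₜ[ℂ] c) := by
    intro i
    simp only [parity, TensorProduct.map_tmul, Algebra.TensorProduct.map_tmul, wedge_apply,
      Algebra.TensorProduct.tmul_mul_tmul, Derivation.coeFn_coe, Derivation.leibniz,
      AlgHom.id_apply, smul_eq_mul, TensorProduct.tmul_add]
    rw [← mul_assoc, ← mul_assoc, ← iota_mul, mul_comm c, add_comm]
  have e2 : ∀ i j, TensorProduct.map
        (wedge (b.coord i) ∘ₗ wedge (b.coord j) ∘ₗ contract ⁅b i, b j⁆)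
        (LinearMap.id : A →ₗ[ℂ] A) ((ω * η) ⊗ₜ[ℂ] (a * c)) =
      TensorProduct.map (wedge (b.coord i) ∘ₗ wedge (b.coord j) ∘ₗ contract ⁅b i, b j⁆)
        (LinearMap.id : A →ₗ[ℂ] A) (ω ⊗ₜ[ℂ] a) * (η ⊗ₜ[ℂ] c) +
      parity g A (ω ⊗ₜ[ℂ] a) *
        TensorProduct.map (wedge (b.coord i) ∘ₗ wedge (b.coord j) ∘ₗ contract ⁅b i, b j⁆)
        (LinearMap.id : A →ₗ[ℂ] A) (η ⊗ₜ[ℂ] c) := by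
    intro i j
    simp only [parity, TensorProduct.map_tmul, Algebra.TensorProduct.map_tmul, wedge_apply,
      Algebra.TensorProduct.tmul_mul_tmul, LinearMap.comp_apply, LinearMap.id_apply,
      AlgHom.id_apply, contract_mul, mul_add, TensorProduct.add_tmul]
    congr 2
    · simp only [mul_assoc]
    · simp only [← mul_assoc]
      rw [mul_assoc (ExteriorAlgebra.ι ℂ (b.coord i)), iota_mul (b.coord j), ← mul_assoc,
        iota_mul (b.coord i), CliffordAlgebra.involute_involute]
  simp only [differential, LinearMap.sub_apply, LinearMap.smul_apply, LinearMap.sum_apply,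
    Algebra.TensorProduct.tmul_mul_tmul, e1, e2, Finset.sum_add_distrib, smul_add, sub_mul, mul_sub,
    Finset.sum_mul, Finset.mul_sum, smul_mul_assoc, mul_smul_comm]
  abel

theorem differential_parity (b : Module.Basis ι ℂ g) (π : g →ₗ⁅ℂ⁆ Derivation ℂ A A)
    (u : Cochains g A) :
    differential b π (parity g A u) = -parity g A (differential b π u) := by
  induction u using TensorProduct.induction_on with
  | zero => simp
  | add u₁ u₂ h₁ h₂ => simp only [map_add, h₁, h₂]; abel
  | tmul ω a =>
  simp only [differential, parity, LinearMap.sub_apply, LinearMap.smul_apply, LinearMap.sum_apply,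
    TensorProduct.map_tmul, Algebra.TensorProduct.map_tmul, LinearMap.comp_apply, map_sub, map_sum,
    map_smul, wedge_apply, parity_contract, map_mul, involute_iota, LinearMap.id_apply,
    AlgHom.id_apply, mul_neg, neg_mul, TensorProduct.neg_tmul, neg_neg, Finset.sum_neg_distrib,
    smul_neg]
  abel

theorem differential_one (b : Module.Basis ι ℂ g) (π : g →ₗ⁅ℂ⁆ Derivation ℂ A A) :
    differential b π 1 = 0 := by
  have h := differential_mul b π 1 1
  rw [map_one (parity g A), mul_one, one_mul, mul_one] at h
  simpa using h

theorem parity_parity (u : Cochains g A) : parity g A (parity g A u) = u := by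
  induction u using TensorProduct.induction_on with
  | zero => simp
  | add u₁ u₂ h₁ h₂ => simp only [map_add, h₁, h₂]
  | tmul ω a =>
    simp only [parity, Algebra.TensorProduct.map_tmul, AlgHom.id_apply,
      CliffordAlgebra.involute_involute]

/-- The algebra of cocycles `ker d`. -/
def cocycles (b : Module.Basis ι ℂ g) (π : g →ₗ⁅ℂ⁆ Derivation ℂ A A) :
    Subalgebra ℂ (Cochains g A) where
  carrier := {u | differential b π u = 0}
  mul_mem' {u v} hu hv := by
    simp only [Set.mem_ofPred_eq] at hu hv ⊢
    rw [differential_mul, hu, hv, zero_mul, mul_zero, add_zero]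
  add_mem' {u v} hu hv := by
    simp only [Set.mem_ofPred_eq] at hu hv ⊢
    rw [map_add, hu, hv, add_zero]
  algebraMap_mem' r := by
    simp only [Set.mem_ofPred_eq]
    rw [Algebra.algebraMap_eq_smul_one, map_smul, differential_one, smul_zero]

/-- The ideal of coboundaries `im d` in the algebra of cocycles. -/
def coboundaries (b : Module.Basis ι ℂ g) (π : g →ₗ⁅ℂ⁆ Derivation ℂ A A) :
    Ideal (cocycles b π) where
  carrier := {z | ∃ u, differential b π u = (z : Cochains g A)}
  zero_mem' := ⟨0, by simp⟩
  add_mem' := by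
    rintro z w ⟨u, hu⟩ ⟨v, hv⟩
    exact ⟨u + v, by rw [map_add, hu, hv]; rfl⟩
  smul_mem' := by
    rintro z w ⟨u, hu⟩
    have hz : differential b π (z : Cochains g A) = 0 := z.2
    refine ⟨parity g A z * u, ?_⟩
    rw [differential_mul, differential_parity, hz, map_zero, neg_zero, zero_mul, zero_add,
      parity_parity, hu]
    rfl

instance coboundaries_isTwoSided (b : Module.Basis ι ℂ g) (π : g →ₗ⁅ℂ⁆ Derivation ℂ A A) :
    (coboundaries b π).IsTwoSided where
  mul_mem_of_left := by
    rintro z w ⟨u, hu⟩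
    have hw : differential b π (w : Cochains g A) = 0 := w.2
    refine ⟨u * w, ?_⟩
    rw [differential_mul, hw, mul_zero, add_zero, hu]
    rfl

/-- The cohomology algebra `H^•(g; A)`, with the multiplication induced from `⋀ g'` and `A`. -/
abbrev Cohomology (b : Module.Basis ι ℂ g) (π : g →ₗ⁅ℂ⁆ Derivation ℂ A A) : Type :=
  cocycles b π ⧸ coboundaries b π

/-- The cochains `⋀ⁿ g' ⊗ A` of degree `n`. -/
def cochainsDeg (g A : Type) [LieRing g] [LieAlgebra ℂ g] [CommRing A] [Algebra ℂ A] (n : ℕ) :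
    Submodule ℂ (Cochains g A) :=
  LinearMap.range (TensorProduct.map (⋀[ℂ]^n (Module.Dual ℂ g)).subtype
    (LinearMap.id : A →ₗ[ℂ] A))

/-- The cohomology `Hⁿ(g; A)`: the classes of the cocycles of degree `n`. -/
def cohomologyDeg (b : Module.Basis ι ℂ g) (π : g →ₗ⁅ℂ⁆ Derivation ℂ A A) (n : ℕ) :
    Submodule ℂ (Cohomology b π) :=
  ((cochainsDeg g A n).comap (cocycles b π).val.toLinearMap).map
    (Ideal.Quotient.mkₐ ℂ (coboundaries b π)).toLinearMap

/-- The space `A^g` of invariants. -/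
def invariants (π : g →ₗ⁅ℂ⁆ Derivation ℂ A A) : Submodule ℂ A where
  carrier := {a | ∀ x, π x a = 0}
  zero_mem' x := map_zero _
  add_mem' {a c} ha hc x := by rw [map_add, ha x, hc x, add_zero]
  smul_mem' r a ha x := by rw [Derivation.map_smul, ha x, smul_zero]

end Complex

end LieCohomology

/-! ## The Lie algebra `sl₂` -/

/-- The Lie algebra `sl(2, ℂ)` of traceless matrices. -/
abbrev SL2 : Type := LieAlgebra.SpecialLinear.sl (Fin 2) ℂ

namespace SL2

theorem val_one_one (X : SL2) : X.val 1 1 = -X.val 0 0 := by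
  have h : Matrix.trace X.val = 0 := X.2
  rw [Matrix.trace_fin_two] at h
  linear_combination h

/-- The element of `sl₂` with coordinates `p, q, r` with respect to `e, h, f`. -/
def ofCoords (p q r : ℂ) : SL2 :=
  ⟨!![q, p; r, -q], by
    change Matrix.trace (!![q, p; r, -q] : Matrix (Fin 2) (Fin 2) ℂ) = 0
    simp [Matrix.trace_fin_two]⟩

/-- The coordinates with respect to `e, h, f`. -/
def coords : SL2 ≃ₗ[ℂ] (Fin 3 → ℂ) where
  toFun X := ![X.val 0 1, X.val 0 0, X.val 1 0]
  map_add' X Y := by ext i; fin_cases i <;> simp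
  map_smul' c X := by ext i; fin_cases i <;> simp
  invFun v := ofCoords (v 0) (v 1) (v 2)
  left_inv X := by
    apply Subtype.ext
    ext i j
    fin_cases i <;> fin_cases j <;> simp [ofCoords, val_one_one]
  right_inv v := by ext i; fin_cases i <;> simp [ofCoords]

/-- The standard basis `e, h, f` of `sl₂`. -/
def basis : Module.Basis (Fin 3) ℂ SL2 := Module.Basis.ofEquivFun coords

/-- The homomorphism from `sl₂` to a Lie algebra sending `e, h, f` to given elements satisfying
`[h, e] = 2e`, `[h, f] = -2f`, `[e, f] = h`. -/
def lift {L : Type} [LieRing L] [LieAlgebra ℂ L] (E H F : L)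
    (hHE : ⁅H, E⁆ = (2 : ℂ) • E) (hHF : ⁅H, F⁆ = (-2 : ℂ) • F) (hEF : ⁅E, F⁆ = H) :
    SL2 →ₗ⁅ℂ⁆ L where
  toFun X := X.val 0 1 • E + X.val 0 0 • H + X.val 1 0 • F
  map_add' X Y := by
    change (X.val 0 1 + Y.val 0 1) • E + (X.val 0 0 + Y.val 0 0) • H +
      (X.val 1 0 + Y.val 1 0) • F = _
    module
  map_smul' c X := by
    change (c * X.val 0 1) • E + (c * X.val 0 0) • H + (c * X.val 1 0) • F = c • _
    module
  map_lie' {X Y} := by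
    have hEH : ⁅E, H⁆ = (-2 : ℂ) • E := by rw [← lie_skew, hHE, neg_smul]
    have hFH : ⁅F, H⁆ = (2 : ℂ) • F := by rw [← lie_skew, hHF, neg_smul, neg_neg]
    have hFE : ⁅F, E⁆ = -H := by rw [← lie_skew, hEF]
    change (X.val * Y.val - Y.val * X.val) 0 1 • E + (X.val * Y.val - Y.val * X.val) 0 0 • H +
      (X.val * Y.val - Y.val * X.val) 1 0 • F = _
    simp only [Matrix.sub_apply, Matrix.mul_apply, Fin.sum_univ_two, val_one_one, lie_add, add_lie,
      lie_smul, smul_lie, lie_self, hHE, hHF, hEF, hEH, hFH, hFE]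
    module

theorem lift_commute {L : Type} [LieRing L] [LieAlgebra ℂ L] {E H F E' H' F' : L} (hHE hHF hEF)
    (hHE' hHF' hEF') (h1 : ⁅E, E'⁆ = 0 ∧ ⁅E, H'⁆ = 0 ∧ ⁅E, F'⁆ = 0)
    (h2 : ⁅H, E'⁆ = 0 ∧ ⁅H, H'⁆ = 0 ∧ ⁅H, F'⁆ = 0)
    (h3 : ⁅F, E'⁆ = 0 ∧ ⁅F, H'⁆ = 0 ∧ ⁅F, F'⁆ = 0) (X Y : SL2) :
    ⁅lift E H F hHE hHF hEF X, lift E' H' F' hHE' hHF' hEF' Y⁆ = 0 := by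
  change ⁅X.val 0 1 • E + X.val 0 0 • H + X.val 1 0 • F,
    Y.val 0 1 • E' + Y.val 0 0 • H' + Y.val 1 0 • F'⁆ = 0
  simp only [lie_add, add_lie, lie_smul, smul_lie, h1, h2, h3, smul_zero, add_zero]

/-- The sum of two commuting homomorphisms. -/
def sum {L : Type} [LieRing L] [LieAlgebra ℂ L] (φ ψ : SL2 →ₗ⁅ℂ⁆ L)
    (h : ∀ X Y, ⁅φ X, ψ Y⁆ = 0) : SL2 →ₗ⁅ℂ⁆ L where
  toFun X := φ X + ψ X
  map_add' X Y := by rw [map_add, map_add]; abel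
  map_smul' c X := by rw [map_smul, map_smul, smul_add]; rfl
  map_lie' {X Y} := by
    have h' : ⁅ψ X, φ Y⁆ = 0 := by rw [← lie_skew, h, neg_zero]
    rw [LieHom.map_lie, LieHom.map_lie, lie_add, add_lie, add_lie, h, h', add_zero, zero_add]

end SL2

/-! ## The extended regular representation on the big cell -/

namespace BigCell

/-- The algebra `ℂ[x, y, ζ, ζ⁻¹]` of regular functions on the big cell
`{ [1, x; 0, 1] [0, -1; 1, 0] [ζ, 0; 0, ζ⁻¹] [1, y; 0, 1] }` of `SL(2, ℂ)`;
`T λ` is the function `ζ^λ`. -/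
abbrev Functions : Type := LaurentPolynomial (MvPolynomial (Fin 2) ℂ)

/-- The coordinate function `x`. -/
def x : Functions := LaurentPolynomial.C (MvPolynomial.X 0)

/-- The coordinate function `y`. -/
def y : Functions := LaurentPolynomial.C (MvPolynomial.X 1)

/-- The functions `ζ^λ`. -/
def zeta (l : ℤ) : Functions := LaurentPolynomial.T l

theorem functions_induction {M : Functions → Prop} (u : Functions)
    (hC : ∀ c : ℂ, M (algebraMap ℂ Functions c)) (hx : M x) (hy : M y) (hz : ∀ l, M (zeta l))
    (hadd : ∀ p q, M p → M q → M (p + q)) (hmul : ∀ p q, M p → M q → M (p * q)) : M u := by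
  induction u using LaurentPolynomial.induction_on' with
  | add p q hp hq => exact hadd p q hp hq
  | C_mul_T n a =>
    refine hmul _ _ ?_ (hz n)
    induction a using MvPolynomial.induction_on with
    | C c => exact hC c
    | add p q hp hq => rw [map_add]; exact hadd _ _ hp hq
    | mul_X p i hp =>
      rw [map_mul]
      refine hmul _ _ hp ?_
      fin_cases i
      · exact hx
      · exact hy

/-- Derivations of `ℂ[x, y, ζ, ζ⁻¹]` are determined by their values on the coordinates. -/
theorem derivation_ext {D E : Derivation ℂ Functions Functions} (hx : D x = E x) (hy : D y = E y)
    (hz : ∀ l, D (zeta l) = E (zeta l)) : D = E := by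
  apply Derivation.ext
  intro u
  induction u using functions_induction with
  | hC c => rw [Derivation.map_algebraMap, Derivation.map_algebraMap]
  | hx => exact hx
  | hy => exact hy
  | hz l => exact hz l
  | hadd p q hp hq => rw [map_add, map_add, hp, hq]
  | hmul p q hp hq => rw [Derivation.leibniz, Derivation.leibniz, hp, hq]

theorem leibniz_of_basis (D : Functions →ₗ[ℂ] Functions)
    (h : ∀ p q m n, D (LaurentPolynomial.C p * LaurentPolynomial.T m *
        (LaurentPolynomial.C q * LaurentPolynomial.T n)) =
      (LaurentPolynomial.C p * LaurentPolynomial.T m) *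
        D (LaurentPolynomial.C q * LaurentPolynomial.T n) +
      (LaurentPolynomial.C q * LaurentPolynomial.T n) *
        D (LaurentPolynomial.C p * LaurentPolynomial.T m)) (u v : Functions) :
    D (u * v) = u • D v + v • D u := by
  simp only [smul_eq_mul]
  induction u using LaurentPolynomial.induction_on' with
  | add p q hp hq => simp only [add_mul, mul_add, map_add, hp, hq]; abel
  | C_mul_T m p =>
  induction v using LaurentPolynomial.induction_on' with
  | add p q hp hq => simp only [add_mul, mul_add, map_add, hp, hq]; abel
  | C_mul_T n q => exact h p q m n

theorem C_mul_T_mul (p q : MvPolynomial (Fin 2) ℂ) (m n : ℤ) :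
    (LaurentPolynomial.C p * LaurentPolynomial.T m *
      (LaurentPolynomial.C q * LaurentPolynomial.T n) : Functions) =
    LaurentPolynomial.C (p * q) * LaurentPolynomial.T (m + n) := by
  rw [LaurentPolynomial.T_add, map_mul]; ring

/-- The linear map on `ℂ[x, y, ζ, ζ⁻¹]` with `p(x, y) ζ^λ ↦ (L λ p)(x, y) ζ^λ`. -/
def coeffMap (L : ℤ → MvPolynomial (Fin 2) ℂ →ₗ[ℂ] MvPolynomial (Fin 2) ℂ) :
    Functions →ₗ[ℂ] Functions :=
  Finsupp.lsum ℂ (fun l => ((AddMonoidAlgebra.lsingle l :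
      MvPolynomial (Fin 2) ℂ →ₗ[MvPolynomial (Fin 2) ℂ] Functions).restrictScalars ℂ) ∘ₗ L l) ∘ₗ
    (AddMonoidAlgebra.coeffLinearEquiv ℂ).toLinearMap

theorem coeffMap_C_mul_T (L : ℤ → MvPolynomial (Fin 2) ℂ →ₗ[ℂ] MvPolynomial (Fin 2) ℂ)
    (p : MvPolynomial (Fin 2) ℂ) (l : ℤ) :
    coeffMap L (LaurentPolynomial.C p * LaurentPolynomial.T l) =
      LaurentPolynomial.C (L l p) * LaurentPolynomial.T l := by
  rw [← LaurentPolynomial.single_eq_C_mul_T, ← LaurentPolynomial.single_eq_C_mul_T]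
  change Finsupp.lsum ℂ _ (Finsupp.single l p) = _
  rw [Finsupp.lsum_single]
  rfl

/-- The partial derivative with respect to `x` (for `i = 0`) or `y` (for `i = 1`). -/
def partialDeriv (i : Fin 2) : Derivation ℂ Functions Functions :=
  Derivation.mk' (coeffMap fun _ => (MvPolynomial.pderiv i : Derivation ℂ _ _)) <|
    leibniz_of_basis _ fun p q m n => by
      rw [C_mul_T_mul, coeffMap_C_mul_T, coeffMap_C_mul_T, coeffMap_C_mul_T]
      simp only [Derivation.coeFn_coe, Derivation.leibniz,
        LaurentPolynomial.T_add, map_add, smul_eq_mul, map_mul]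
      ring

/-- The Euler derivation `a = ζ ∂/∂ζ`. -/
def euler : Derivation ℂ Functions Functions :=
  Derivation.mk' (coeffMap fun l => (l : ℂ) • LinearMap.id) <|
    leibniz_of_basis _ fun p q m n => by
      rw [C_mul_T_mul, coeffMap_C_mul_T, coeffMap_C_mul_T, coeffMap_C_mul_T]
      simp only [LinearMap.smul_apply, LinearMap.id_apply,
        LaurentPolynomial.T_add, map_mul, MvPolynomial.smul_eq_C_mul, Int.cast_add, map_add]
      ring

theorem x_eq : x = LaurentPolynomial.C (MvPolynomial.X 0) * LaurentPolynomial.T 0 := by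
  rw [LaurentPolynomial.T_zero, mul_one]; rfl

theorem y_eq : y = LaurentPolynomial.C (MvPolynomial.X 1) * LaurentPolynomial.T 0 := by
  rw [LaurentPolynomial.T_zero, mul_one]; rfl

theorem zeta_eq (l : ℤ) : zeta l = LaurentPolynomial.C 1 * LaurentPolynomial.T l := by
  rw [map_one, one_mul]; rfl

theorem zeta_add (k l : ℤ) : zeta (k + l) = zeta k * zeta l := LaurentPolynomial.T_add k l

theorem zeta_zero : zeta 0 = 1 := LaurentPolynomial.T_zero

theorem partialDeriv_x_x : partialDeriv 0 x = 1 := by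
  rw [x_eq, partialDeriv, Derivation.coe_mk', coeffMap_C_mul_T]; simp

theorem partialDeriv_x_y : partialDeriv 0 y = 0 := by
  rw [y_eq, partialDeriv, Derivation.coe_mk', coeffMap_C_mul_T]; simp

theorem partialDeriv_y_x : partialDeriv 1 x = 0 := by
  rw [x_eq, partialDeriv, Derivation.coe_mk', coeffMap_C_mul_T]; simp

theorem partialDeriv_y_y : partialDeriv 1 y = 1 := by
  rw [y_eq, partialDeriv, Derivation.coe_mk', coeffMap_C_mul_T]; simp

theorem partialDeriv_zeta (i : Fin 2) (l : ℤ) : partialDeriv i (zeta l) = 0 := by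
  rw [zeta_eq, partialDeriv, Derivation.coe_mk', coeffMap_C_mul_T]; simp

theorem euler_x : euler x = 0 := by
  rw [x_eq, euler, Derivation.coe_mk', coeffMap_C_mul_T]; simp

theorem euler_y : euler y = 0 := by
  rw [y_eq, euler, Derivation.coe_mk', coeffMap_C_mul_T]; simp

theorem euler_zeta (l : ℤ) : euler (zeta l) = (l : Functions) * zeta l := by
  rw [zeta_eq, euler, Derivation.coe_mk', coeffMap_C_mul_T]
  simp [MvPolynomial.smul_eq_C_mul]

/-- The left action of `e, h, f`: with `β = x`, `γ = -∂/∂x`, `γ' = ∂/∂y` and `a = ζ ∂/∂ζ`, these are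
`γ`, `2βγ + a` and `-β²γ - βa + γ' ζ⁻²`. -/
def leftE : Derivation ℂ Functions Functions := -partialDeriv 0

/-- The left action of `h`. -/
def leftH : Derivation ℂ Functions Functions := euler - (2 : ℂ) • (x • partialDeriv 0)

/-- The left action of `f`. -/
def leftF : Derivation ℂ Functions Functions :=
  -(x • euler) + (x * x) • partialDeriv 0 + zeta (-2) • partialDeriv 1

/-- The right action of `e, h, f`: with `β' = -y`, `γ' = ∂/∂y`, `γ = -∂/∂x` and `a = ζ ∂/∂ζ`, these
are `γ'`, `2β'γ' + a` and `-β'²γ' - β'a + γ ζ⁻²`. -/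
def rightE : Derivation ℂ Functions Functions := partialDeriv 1

/-- The right action of `h`. -/
def rightH : Derivation ℂ Functions Functions := euler - (2 : ℂ) • (y • partialDeriv 1)

/-- The right action of `f`. -/
def rightF : Derivation ℂ Functions Functions :=
  y • euler - (y * y) • partialDeriv 1 - zeta (-2) • partialDeriv 0


set_option linter.unusedSimpArgs false in
set_option linter.unusedTactic false in
/-- The left and the right operators satisfy the relations of `sl₂`, and they commute. -/
theorem commutators :
    (⁅leftH, leftE⁆ = (2 : ℂ) • leftE ∧ ⁅leftH, leftF⁆ = (-2 : ℂ) • leftF ∧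
      ⁅leftE, leftF⁆ = leftH) ∧
    (⁅rightH, rightE⁆ = (2 : ℂ) • rightE ∧ ⁅rightH, rightF⁆ = (-2 : ℂ) • rightF ∧
      ⁅rightE, rightF⁆ = rightH) ∧
    (⁅leftE, rightE⁆ = 0 ∧ ⁅leftE, rightH⁆ = 0 ∧ ⁅leftE, rightF⁆ = 0) ∧
    (⁅leftH, rightE⁆ = 0 ∧ ⁅leftH, rightH⁆ = 0 ∧ ⁅leftH, rightF⁆ = 0) ∧
    (⁅leftF, rightE⁆ = 0 ∧ ⁅leftF, rightH⁆ = 0 ∧ ⁅leftF, rightF⁆ = 0) := by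
  refine ⟨⟨?_, ?_, ?_⟩, ⟨?_, ?_, ?_⟩, ⟨?_, ?_, ?_⟩, ⟨?_, ?_, ?_⟩, ⟨?_, ?_, ?_⟩⟩ <;>
  refine derivation_ext ?_ ?_ fun l => ?_ <;>
  · simp only [leftE, leftH, leftF, rightE, rightH, rightF, Derivation.commutator_apply,
      Derivation.add_apply, Derivation.sub_apply, Derivation.neg_apply, Derivation.smul_apply,
      Derivation.zero_apply, two_smul, neg_smul, smul_eq_mul, map_add, map_sub, map_neg, map_zero,
      Derivation.leibniz, Derivation.map_one_eq_zero, Derivation.map_intCast, partialDeriv_x_x,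
      partialDeriv_x_y, partialDeriv_y_x, partialDeriv_y_y, partialDeriv_zeta, euler_x, euler_y,
      euler_zeta]
    push_cast
    ring

/-- The left regular action `π_l` of `sl₂`. -/
def leftAction : SL2 →ₗ⁅ℂ⁆ Derivation ℂ Functions Functions :=
  SL2.lift leftE leftH leftF commutators.1.1 commutators.1.2.1 commutators.1.2.2

/-- The right regular action `π_r` of `sl₂`. -/
def rightAction : SL2 →ₗ⁅ℂ⁆ Derivation ℂ Functions Functions :=
  SL2.lift rightE rightH rightF commutators.2.1.1 commutators.2.1.2.1 commutators.2.1.2.2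

theorem left_right_commute (X Y : SL2) : ⁅leftAction X, rightAction Y⁆ = 0 := by
  obtain ⟨-, -, h1, h2, h3⟩ := commutators
  exact SL2.lift_commute _ _ _ _ _ _ h1 h2 h3 X Y

/-- The diagonal action `X ↦ π_l(X) + π_r(X)` of `sl₂`. -/
def diagonalAction : SL2 →ₗ⁅ℂ⁆ Derivation ℂ Functions Functions :=
  SL2.sum leftAction rightAction left_right_commute

end BigCell

/-! ## The target algebra -/

/-- The algebra `ℂ[P]^W`: here `P ≅ ℤ` is the weight lattice of `sl₂`, the element `T λ` of
`ℂ[T, T⁻¹]` is the basis element of the group algebra `ℂ[P]` attached to `λ ∈ P`, and the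
nontrivial element of the Weyl group `W ≅ ℤ/2` acts by `λ ↦ -λ`. -/
def weylInvariants : Subalgebra ℂ ℂ[T;T⁻¹] :=
  AlgHom.equalizer (LaurentPolynomial.invert (R := ℂ)).toAlgHom (AlgHom.id ℂ ℂ[T;T⁻¹])

/-- The commutative superalgebra `ℂ[P]^W ⊗ ⋀ ℂ²`. -/
abbrev Target : Type := weylInvariants ⊗[ℂ] ExteriorAlgebra ℂ (Fin 2 → ℂ)

/-- The component `ℂ[P]^W ⊗ ⋀ⁿ ℂ²` of degree `n`. -/
def targetDeg (n : ℕ) : Submodule ℂ Target :=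
  LinearMap.range (TensorProduct.map (LinearMap.id : weylInvariants →ₗ[ℂ] weylInvariants)
    (⋀[ℂ]^n (Fin 2 → ℂ)).subtype)

end

noncomputable section

/-! ## The invariants of the Weyl group -/

namespace WeylInvariants

open LaurentPolynomial

/-- The character `T + T⁻¹` of the two-dimensional representation. -/
def char : weylInvariants :=
  ⟨T 1 + T (-1), by
    change invert (T 1 + T (-1) : ℂ[T;T⁻¹]) = T 1 + T (-1)
    rw [map_add, invert_T, invert_T, neg_neg, add_comm]⟩

theorem T_add_T_neg_mem (n : ℕ) :
    (T n + T (-n) : ℂ[T;T⁻¹]) ∈ (Polynomial.aeval (R := ℂ) (T 1 + T (-1) : ℂ[T;T⁻¹])).range := by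
  have h : (T 1 * T (-1) : ℂ[T;T⁻¹]) = 1 := by rw [← T_add, add_neg_cancel, T_zero]
  refine ⟨Polynomial.dickson 1 1 n, ?_⟩
  have h2 := Polynomial.dickson_one_one_eval_add_inv (T 1 : ℂ[T;T⁻¹]) (T (-1)) h n
  rw [T_pow, T_pow, mul_one, mul_neg_one] at h2
  change Polynomial.aeval (T 1 + T (-1) : ℂ[T;T⁻¹]) _ = _
  rw [← h2, ← Polynomial.eval_map_algebraMap, Polynomial.map_dickson, map_one]

theorem add_invert_mem (f : ℂ[T;T⁻¹]) :
    f + invert f ∈ (Polynomial.aeval (R := ℂ) (T 1 + T (-1) : ℂ[T;T⁻¹])).range := by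
  induction f using LaurentPolynomial.induction_on' with
  | add p q hp hq =>
    rw [map_add, add_add_add_comm]
    exact add_mem hp hq
  | C_mul_T n a =>
    rw [map_mul, invert_C, invert_T, ← mul_add, ← smul_eq_C_mul]
    refine Subalgebra.smul_mem _ ?_ a
    rcases Int.eq_nat_or_neg n with ⟨m, rfl | rfl⟩
    · exact T_add_T_neg_mem m
    · rw [neg_neg, add_comm (T (-(m : ℤ)))]
      exact T_add_T_neg_mem m

theorem aeval_char_surjective : Function.Surjective (Polynomial.aeval (R := ℂ) char) := by
  rintro ⟨f, hf⟩
  obtain ⟨p, hp⟩ := add_invert_mem ((1 / 2 : ℂ) • f)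
  have hf' : invert f = f := hf
  refine ⟨p, Subtype.ext ?_⟩
  rw [map_smul, hf', ← add_smul, add_halves, one_smul] at hp
  rw [← Subalgebra.coe_val, ← Polynomial.aeval_algHom_apply]
  exact hp

theorem exists_add_inv (w : ℂ) : ∃ c : ℂˣ, (c : ℂ) + (c⁻¹ : ℂˣ) = w := by
  obtain ⟨s, hs⟩ := IsAlgClosed.exists_pow_nat_eq (w ^ 2 - 4) (n := 2) (by norm_num)
  have h : (w + s) / 2 * ((w - s) / 2) = 1 := by linear_combination -hs / 4
  refine ⟨⟨_, _, h, by rw [mul_comm, h]⟩, ?_⟩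
  change (w + s) / 2 + (w - s) / 2 = w
  ring

theorem aeval_char_injective : Function.Injective (Polynomial.aeval (R := ℂ) char) := by
  rw [injective_iff_map_eq_zero]
  intro p hp
  have h1 : Polynomial.aeval (T 1 + T (-1) : ℂ[T;T⁻¹]) p = 0 := by
    have := congrArg weylInvariants.val hp
    rwa [← Polynomial.aeval_algHom_apply, map_zero] at this
  refine Polynomial.funext fun w => ?_
  obtain ⟨c, rfl⟩ := exists_add_inv w
  have h2 := congrArg (eval₂ (RingHom.id ℂ) c) h1
  rw [Polynomial.aeval_def, Polynomial.hom_eval₂, map_add, eval₂_T, eval₂_T, map_zero] at h2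
  rw [Polynomial.eval_zero, ← h2, zpow_one, zpow_neg_one, Polynomial.eval]
  congr 1
  ext r
  simp

/-- `ℂ[P]^W` is the polynomial algebra in `T + T⁻¹`. -/
def equivPolynomial : weylInvariants ≃ₐ[ℂ] Polynomial ℂ :=
  (AlgEquiv.ofBijective (Polynomial.aeval char)
    ⟨aeval_char_injective, aeval_char_surjective⟩).symm

end WeylInvariants

/-! ## Cochains of `sl₂` in coordinates -/

namespace SL2

open LieCohomology

theorem lie_basis : ⁅basis 0, basis 1⁆ = (-2 : ℂ) • basis 0 ∧ ⁅basis 0, basis 2⁆ = basis 1 ∧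
    ⁅basis 1, basis 2⁆ = (-2 : ℂ) • basis 2 := by
  refine ⟨?_, ?_, ?_⟩ <;>
  · apply Subtype.ext
    ext i j
    fin_cases i <;> fin_cases j <;>
    simp [basis, coords, ofCoords, Ring.lie_def, Module.Basis.coe_ofEquivFun] <;> norm_num

/-- The exterior algebra of the dual of `sl₂`. -/
abbrev Forms : Type := ExteriorAlgebra ℂ (Module.Dual ℂ SL2)

/-- The elements of degree one of the exterior algebra attached to the dual basis. -/
def form (i : Fin 3) : Forms := ExteriorAlgebra.ι ℂ (basis.coord i)

theorem form_sq (i : Fin 3) : form i * form i = 0 := ExteriorAlgebra.ι_sq_zero _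

theorem form_swap (i j : Fin 3) : form j * form i = -(form i * form j) :=
  eq_neg_of_add_eq_zero_left (ExteriorAlgebra.ι_add_mul_swap _ _)

theorem form_sq_mul (i : Fin 3) (ω : Forms) : form i * (form i * ω) = 0 := by
  rw [← mul_assoc, form_sq, zero_mul]

theorem form_swap_mul (i j : Fin 3) (ω : Forms) :
    form j * (form i * ω) = -(form i * (form j * ω)) := by
  rw [← mul_assoc, form_swap, neg_mul, mul_assoc]

theorem contract_form_mul (i j : Fin 3) (ω : Forms) :
    contract (basis j) (form i * ω) =
      (if j = i then ω else 0) - form i * contract (basis j) ω := by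
  rw [form, contract_iota_mul, Module.Basis.coord_apply, Module.Basis.repr_self,
    Finsupp.single_apply, ite_smul, one_smul, zero_smul]

theorem contract_form (i j : Fin 3) :
    contract (basis j) (form i) = if j = i then (1 : Forms) else 0 := by
  rw [← mul_one (form i), contract_form_mul, contract_one, mul_zero, sub_zero]

theorem contract_smul (c : ℂ) (X : SL2) : contract (c • X) = c • contract X := by
  simp [contract]

theorem contract_zero : contract (0 : SL2) = 0 := by
  simp [contract]

theorem wedge_coord (i : Fin 3) (ω : Forms) : wedge (basis.coord i) ω = form i * ω := rfl

section Coordinates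

variable {A : Type} [CommRing A] [Algebra ℂ A] (π : SL2 →ₗ⁅ℂ⁆ Derivation ℂ A A)

theorem differential_tmul (ω : Forms) (a : A) :
    differential basis π (ω ⊗ₜ[ℂ] a) = (form 0 * ω) ⊗ₜ[ℂ] π (basis 0) a +
      (form 1 * ω) ⊗ₜ[ℂ] π (basis 1) a + (form 2 * ω) ⊗ₜ[ℂ] π (basis 2) a +
      ((2 : ℂ) • (form 0 * (form 1 * contract (basis 0) ω)) -
        form 0 * (form 2 * contract (basis 1) ω) +
        (2 : ℂ) • (form 1 * (form 2 * contract (basis 2) ω))) ⊗ₜ[ℂ] a := by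
  obtain ⟨h1, h2, h3⟩ := lie_basis
  have h1' : ⁅basis 1, basis 0⁆ = (2 : ℂ) • basis 0 := by rw [← lie_skew, h1]; module
  have h2' : ⁅basis 2, basis 0⁆ = (-1 : ℂ) • basis 1 := by rw [← lie_skew, h2]; module
  have h3' : ⁅basis 2, basis 1⁆ = (2 : ℂ) • basis 2 := by rw [← lie_skew, h3]; module
  simp only [differential, Fin.sum_univ_three, h1, h2, h3, h1', h2', h3', lie_self, contract_zero,
    contract_smul, LinearMap.sub_apply, LinearMap.add_apply, LinearMap.smul_apply,
    TensorProduct.map_tmul, LinearMap.comp_apply, LinearMap.zero_apply, LinearMap.id_apply,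
    Derivation.coeFn_coe, map_smul, wedge_coord, map_zero, TensorProduct.zero_tmul,
    form_swap_mul 0 1, form_swap_mul 0 2, form_swap_mul 1 2, smul_neg,
    TensorProduct.add_tmul, TensorProduct.sub_tmul, ← TensorProduct.smul_tmul',
    TensorProduct.neg_tmul]
  module

/-- Cochains of degree `0`. -/
def cochain0 (a : A) : Cochains SL2 A := 1 ⊗ₜ a

/-- Cochains of degree `1`. -/
def cochain1 (a b c : A) : Cochains SL2 A := form 0 ⊗ₜ a + form 1 ⊗ₜ b + form 2 ⊗ₜ c

/-- Cochains of degree `2`. -/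
def cochain2 (a b c : A) : Cochains SL2 A :=
  (form 0 * form 1) ⊗ₜ a + (form 0 * form 2) ⊗ₜ b + (form 1 * form 2) ⊗ₜ c

/-- Cochains of degree `3`. -/
def cochain3 (a : A) : Cochains SL2 A := (form 0 * (form 1 * form 2)) ⊗ₜ a

theorem differential_cochain0 (a : A) :
    differential basis π (cochain0 a) =
      cochain1 (π (basis 0) a) (π (basis 1) a) (π (basis 2) a) := by
  simp [cochain0, cochain1, differential_tmul, contract_one]

theorem differential_cochain1 (a b c : A) :
    differential basis π (cochain1 a b c) =
      cochain2 (π (basis 0) b - π (basis 1) a + (2 : ℂ) • a)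
        (π (basis 0) c - π (basis 2) a - b)
        (π (basis 1) c - π (basis 2) b + (2 : ℂ) • c) := by
  simp only [cochain1, cochain2, differential_tmul, map_add, contract_form, form_sq,
    form_swap 0 1, form_swap 0 2, form_swap 1 2, mul_one, mul_zero, Fin.isValue, if_true,
    zero_ne_one, one_ne_zero, if_false, Fin.reduceEq, TensorProduct.tmul_add,
    TensorProduct.tmul_sub, TensorProduct.tmul_smul, TensorProduct.neg_tmul,
    TensorProduct.zero_tmul, smul_zero, TensorProduct.smul_tmul', sub_zero, zero_sub, add_zero,
    zero_add]
  module

theorem differential_cochain2 (a b c : A) :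
    differential basis π (cochain2 a b c) =
      cochain3 (π (basis 0) c - π (basis 1) b + π (basis 2) a) := by
  simp only [cochain2, cochain3, differential_tmul, map_add, contract_form, contract_form_mul,
    form_sq, form_sq_mul, form_swap_mul 0 1, form_swap_mul 0 2, form_swap_mul 1 2,
    form_swap 0 2, form_swap 1 2, mul_one, mul_zero, Fin.isValue, if_true,
    zero_ne_one, one_ne_zero, if_false, Fin.reduceEq, TensorProduct.tmul_add,
    TensorProduct.tmul_sub, TensorProduct.neg_tmul, mul_neg, neg_neg,
    TensorProduct.zero_tmul, smul_zero, sub_zero, zero_sub, add_zero,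
    zero_add, neg_zero, smul_neg, add_neg_cancel]
  abel

theorem differential_cochain3 (a : A) : differential basis π (cochain3 a) = 0 := by
  simp only [cochain3, differential_tmul, contract_form, contract_form_mul,
    form_sq, form_sq_mul, form_swap_mul 0 1, form_swap_mul 0 2, form_swap_mul 1 2,
    form_swap 1 2, mul_one, mul_zero, Fin.isValue, if_true,
    zero_ne_one, one_ne_zero, if_false, Fin.reduceEq, mul_neg, neg_neg, 
    TensorProduct.zero_tmul, smul_zero, sub_zero, zero_sub, add_zero, neg_zero]

theorem cochain0_add (a a' : A) : cochain0 (a + a') = cochain0 a + cochain0 a' :=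
  TensorProduct.tmul_add _ _ _

theorem cochain1_add (a b c a' b' c' : A) :
    cochain1 (a + a') (b + b') (c + c') = cochain1 a b c + cochain1 a' b' c' := by
  simp only [cochain1, TensorProduct.tmul_add]; abel

theorem cochain2_add (a b c a' b' c' : A) :
    cochain2 (a + a') (b + b') (c + c') = cochain2 a b c + cochain2 a' b' c' := by
  simp only [cochain2, TensorProduct.tmul_add]; abel

theorem cochain3_add (a a' : A) : cochain3 (a + a') = cochain3 a + cochain3 a' :=
  TensorProduct.tmul_add _ _ _

theorem cochain0_zero : cochain0 (0 : A) = 0 := TensorProduct.tmul_zero _ _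

theorem cochain1_zero : cochain1 (0 : A) 0 0 = 0 := by simp [cochain1]

theorem cochain2_zero : cochain2 (0 : A) 0 0 = 0 := by simp [cochain2]

theorem cochain3_zero : cochain3 (0 : A) = 0 := TensorProduct.tmul_zero _ _

/-- The coefficient of the monomial of degree zero of a form. -/
def augmentation : Forms →ₗ[ℂ] ℂ := ExteriorAlgebra.algebraMapInv.toLinearMap

/-- The `A`-valued map on cochains defined by a linear functional on the forms. -/
def coefficient (κ : Forms →ₗ[ℂ] ℂ) : Cochains SL2 A →ₗ[ℂ] A :=
  (TensorProduct.lid ℂ A).toLinearMap ∘ₗ TensorProduct.map κ LinearMap.id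

theorem coefficient_tmul (κ : Forms →ₗ[ℂ] ℂ) (ω : Forms) (a : A) :
    coefficient κ (ω ⊗ₜ a) = κ ω • a := by
  simp [coefficient]

theorem augmentation_one : augmentation 1 = 1 := map_one ExteriorAlgebra.algebraMapInv

theorem augmentation_form_mul (i : Fin 3) (ω : Forms) : augmentation (form i * ω) = 0 := by
  change ExteriorAlgebra.algebraMapInv (form i * ω) = 0
  rw [map_mul, form, ExteriorAlgebra.algebraMapInv, ExteriorAlgebra.lift_ι_apply,
    LinearMap.zero_apply, zero_mul]

theorem augmentation_form (i : Fin 3) : augmentation (form i) = 0 := by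
  rw [← mul_one (form i), augmentation_form_mul]

theorem cochain_eq_zero {a a₀ a₁ a₂ b₀ b₁ b₂ c : A}
    (h : cochain0 a + cochain1 a₀ a₁ a₂ + cochain2 b₀ b₁ b₂ + cochain3 c = 0) :
    a = 0 ∧ (a₀ = 0 ∧ a₁ = 0 ∧ a₂ = 0) ∧ (b₀ = 0 ∧ b₁ = 0 ∧ b₂ = 0) ∧ c = 0 := by
  have key (κ : Forms →ₗ[ℂ] ℂ) : κ 1 • a + (κ (form 0) • a₀ + κ (form 1) • a₁ + κ (form 2) • a₂) +
      (κ (form 0 * form 1) • b₀ + κ (form 0 * form 2) • b₁ + κ (form 1 * form 2) • b₂) +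
      κ (form 0 * (form 1 * form 2)) • c = 0 := by
    simpa only [cochain0, cochain1, cochain2, cochain3, map_add, coefficient_tmul, map_zero] using
      congrArg (coefficient κ) h
  have h0 := key augmentation
  have h1 (i : Fin 3) := key (augmentation ∘ₗ contract (basis i))
  have h2 (i j : Fin 3) := key (augmentation ∘ₗ contract (basis j) ∘ₗ contract (basis i))
  have h3 := key (augmentation ∘ₗ contract (basis 2) ∘ₗ contract (basis 1) ∘ₗ contract (basis 0))
  have h10 := h1 0
  have h11 := h1 1
  have h12 := h1 2
  have h20 := h2 0 1
  have h21 := h2 0 2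
  have h22 := h2 1 2
  simp only [LinearMap.comp_apply, contract_form, contract_form_mul, contract_one, Fin.isValue,
    if_true, zero_ne_one, one_ne_zero, if_false, Fin.reduceEq, augmentation_one, augmentation_form,
    augmentation_form_mul, map_zero, mul_zero, sub_zero, zero_sub, map_neg, zero_smul,
    one_smul, add_zero, zero_add, mul_one, neg_zero] at h0 h10 h11 h12 h20 h21 h22 h3
  exact ⟨h0, ⟨h10, h11, h12⟩, ⟨h20, h21, h22⟩, h3⟩

end Coordinates

end SL2

/-! ## Degrees -/

namespace SL2

open LieCohomology

theorem iota_eq_sum (φ : Module.Dual ℂ SL2) :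
    ExteriorAlgebra.ι ℂ φ = ∑ i, φ (basis i) • form i := by
  simp only [form, ← map_smul, ← map_sum]
  congr 1
  refine basis.ext fun j => ?_
  simp

theorem form_mem (i : Fin 3) : form i ∈ ⋀[ℂ]^1 (Module.Dual ℂ SL2) := by
  rw [ExteriorAlgebra.exteriorPower, pow_one]
  exact ⟨_, rfl⟩

theorem form_mul_mem {n : ℕ} (i : Fin 3) {ω : Forms} (h : ω ∈ ⋀[ℂ]^n (Module.Dual ℂ SL2)) :
    form i * ω ∈ ⋀[ℂ]^(n + 1) (Module.Dual ℂ SL2) := by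
  rw [ExteriorAlgebra.exteriorPower, pow_succ']
  exact Submodule.mul_mem_mul ⟨_, rfl⟩ h

/-- The span of the monomials of degree `n` in the dual basis. -/
def monomialSpan : ℕ → Submodule ℂ Forms
  | 0 => Submodule.span ℂ {1}
  | 1 => Submodule.span ℂ {form 0, form 1, form 2}
  | 2 => Submodule.span ℂ {form 0 * form 1, form 0 * form 2, form 1 * form 2}
  | 3 => Submodule.span ℂ {form 0 * (form 1 * form 2)}
  | _ => ⊥

theorem form_mul_mem_monomialSpan (n : ℕ) (i : Fin 3) {ω : Forms} (h : ω ∈ monomialSpan n) :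
    form i * ω ∈ monomialSpan (n + 1) := by
  have mono {s t : Set Forms} (hst : ∀ η ∈ s, form i * η ∈ Submodule.span ℂ t)
      (h : ω ∈ Submodule.span ℂ s) : form i * ω ∈ Submodule.span ℂ t :=
    (Submodule.span_le (p := (Submodule.span ℂ t).comap (LinearMap.mulLeft ℂ (form i)))).2 hst h
  have s0 {η : Forms} {t : Set Forms} (h : η = 0) : η ∈ Submodule.span ℂ t :=
    h ▸ zero_mem _
  have s1 {η : Forms} {t : Set Forms} (h : η ∈ t) : η ∈ Submodule.span ℂ t :=
    Submodule.subset_span h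
  have s2 {η : Forms} {t : Set Forms} (h : η ∈ t) : -η ∈ Submodule.span ℂ t :=
    neg_mem (Submodule.subset_span h)
  match n with
  | 0 =>
    refine mono ?_ h
    rintro η rfl
    rw [mul_one]
    fin_cases i <;> exact s1 (by simp)
  | 1 =>
    refine mono ?_ h
    rintro η (rfl | rfl | rfl) <;> fin_cases i
    · exact s0 (form_sq 0)
    · exact form_swap 0 1 ▸ s2 (by simp)
    · exact form_swap 0 2 ▸ s2 (by simp)
    · exact s1 (by simp)
    · exact s0 (form_sq 1)
    · exact form_swap 1 2 ▸ s2 (by simp)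
    · exact s1 (by simp)
    · exact s1 (by simp)
    · exact s0 (form_sq 2)
  | 2 =>
    refine mono ?_ h
    rintro η (rfl | rfl | rfl) <;> fin_cases i
    · exact s0 (form_sq_mul 0 _)
    · exact s0 (by simp [form_swap_mul 0 1, form_sq])
    · exact s1 (by simp [form_swap_mul 0 2, form_swap 1 2])
    · exact s0 (form_sq_mul 0 _)
    · exact form_swap_mul 0 1 (form 2) ▸ s2 (by simp)
    · exact s0 (by simp [form_swap_mul 0 2, form_sq])
    · exact s1 (by simp)
    · exact s0 (form_sq_mul 1 _)
    · exact s0 (by simp [form_swap_mul 1 2, form_sq])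
  | 3 =>
    refine (Submodule.span_le (p := (⊥ : Submodule ℂ Forms).comap
      (LinearMap.mulLeft ℂ (form i)))).2 ?_ h
    rintro η rfl
    change form i * _ = 0
    fin_cases i
    · exact form_sq_mul 0 _
    · simp [form_swap_mul 0 1, form_sq_mul]
    · simp [form_swap_mul 0 2, form_swap_mul 1 2, form_sq]
  | n + 4 =>
    obtain rfl : ω = 0 := h
    rw [mul_zero]
    exact zero_mem _

theorem mem_monomialSpan {n : ℕ} {ω : Forms} (h : ω ∈ ⋀[ℂ]^n (Module.Dual ℂ SL2)) :
    ω ∈ monomialSpan n := by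
  rw [ExteriorAlgebra.exteriorPower] at h
  induction n generalizing ω with
  | zero =>
    rw [pow_zero, Submodule.one_eq_span] at h
    exact h
  | succ n ih =>
    rw [pow_succ'] at h
    induction h using Submodule.mul_induction_on' with
    | mem_mul_mem η hη θ hθ =>
      obtain ⟨φ, rfl⟩ := hη
      rw [iota_eq_sum, Finset.sum_mul]
      refine sum_mem fun i _ => ?_
      rw [smul_mul_assoc]
      exact Submodule.smul_mem _ _ (form_mul_mem_monomialSpan n i (ih hθ))
    | add η _ θ _ h1 h2 => exact add_mem h1 h2

variable {A : Type} [CommRing A] [Algebra ℂ A]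

theorem tmul_mem_cochainsDeg {n : ℕ} {ω : Forms} (h : ω ∈ ⋀[ℂ]^n (Module.Dual ℂ SL2)) (a : A) :
    ω ⊗ₜ[ℂ] a ∈ cochainsDeg SL2 A n :=
  ⟨(⟨ω, h⟩ : ⋀[ℂ]^n (Module.Dual ℂ SL2)) ⊗ₜ a, by simp⟩

theorem cochainsDeg_le {n : ℕ} {S : AddSubmonoid (Cochains SL2 A)}
    (h : ∀ ω ∈ ⋀[ℂ]^n (Module.Dual ℂ SL2), ∀ a : A, ω ⊗ₜ[ℂ] a ∈ S) {u : Cochains SL2 A}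
    (hu : u ∈ cochainsDeg SL2 A n) : u ∈ S := by
  obtain ⟨w, rfl⟩ := hu
  induction w using TensorProduct.induction_on with
  | zero => rw [map_zero]; exact zero_mem _
  | add v w hv hw => rw [map_add]; exact add_mem hv hw
  | tmul ω a => exact h ω ω.2 a

theorem mem_cochainsDeg_zero {u : Cochains SL2 A} :
    u ∈ cochainsDeg SL2 A 0 ↔ ∃ a, u = cochain0 a := by
  refine ⟨cochainsDeg_le (S := ⟨⟨{u | ∃ a, u = cochain0 a}, ?_⟩, 0, cochain0_zero.symm⟩) ?_, ?_⟩
  · rintro _ _ ⟨a, rfl⟩ ⟨b, rfl⟩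
    exact ⟨a + b, (cochain0_add a b).symm⟩
  · intro ω hω a
    obtain ⟨c, rfl⟩ := Submodule.mem_span_singleton.1 (mem_monomialSpan hω)
    exact ⟨c • a, TensorProduct.smul_tmul _ _ _⟩
  · rintro ⟨a, rfl⟩
    refine tmul_mem_cochainsDeg ?_ a
    rw [ExteriorAlgebra.exteriorPower, pow_zero]
    exact Submodule.one_le.1 le_rfl

theorem mem_cochainsDeg_one {u : Cochains SL2 A} :
    u ∈ cochainsDeg SL2 A 1 ↔ ∃ a b c, u = cochain1 a b c := by
  refine ⟨cochainsDeg_le (S := ⟨⟨{u | ∃ a b c, u = cochain1 a b c}, ?_⟩, 0, 0, 0,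
    cochain1_zero.symm⟩) ?_, ?_⟩
  · rintro _ _ ⟨a, b, c, rfl⟩ ⟨a', b', c', rfl⟩
    exact ⟨_, _, _, (cochain1_add a b c a' b' c').symm⟩
  · intro ω hω a
    obtain ⟨p, q, r, rfl⟩ := Submodule.mem_span_triple.1 (mem_monomialSpan hω)
    exact ⟨p • a, q • a, r • a, by simp [cochain1, TensorProduct.add_tmul, TensorProduct.smul_tmul]⟩
  · rintro ⟨a, b, c, rfl⟩
    exact add_mem (add_mem (tmul_mem_cochainsDeg (form_mem _) _)
      (tmul_mem_cochainsDeg (form_mem _) _)) (tmul_mem_cochainsDeg (form_mem _) _)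

theorem mem_cochainsDeg_two {u : Cochains SL2 A} :
    u ∈ cochainsDeg SL2 A 2 ↔ ∃ a b c, u = cochain2 a b c := by
  refine ⟨cochainsDeg_le (S := ⟨⟨{u | ∃ a b c, u = cochain2 a b c}, ?_⟩, 0, 0, 0,
    cochain2_zero.symm⟩) ?_, ?_⟩
  · rintro _ _ ⟨a, b, c, rfl⟩ ⟨a', b', c', rfl⟩
    exact ⟨_, _, _, (cochain2_add a b c a' b' c').symm⟩
  · intro ω hω a
    obtain ⟨p, q, r, rfl⟩ := Submodule.mem_span_triple.1 (mem_monomialSpan hω)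
    exact ⟨p • a, q • a, r • a, by simp [cochain2, TensorProduct.add_tmul, TensorProduct.smul_tmul]⟩
  · rintro ⟨a, b, c, rfl⟩
    have h (i j : Fin 3) := form_mul_mem i (form_mem j)
    exact add_mem (add_mem (tmul_mem_cochainsDeg (h _ _) _)
      (tmul_mem_cochainsDeg (h _ _) _)) (tmul_mem_cochainsDeg (h _ _) _)

theorem mem_cochainsDeg_three {u : Cochains SL2 A} :
    u ∈ cochainsDeg SL2 A 3 ↔ ∃ a, u = cochain3 a := by
  refine ⟨cochainsDeg_le (S := ⟨⟨{u | ∃ a, u = cochain3 a}, ?_⟩, 0, cochain3_zero.symm⟩) ?_, ?_⟩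
  · rintro _ _ ⟨a, rfl⟩ ⟨b, rfl⟩
    exact ⟨a + b, (cochain3_add a b).symm⟩
  · intro ω hω a
    obtain ⟨c, rfl⟩ := Submodule.mem_span_singleton.1 (mem_monomialSpan hω)
    exact ⟨c • a, TensorProduct.smul_tmul _ _ _⟩
  · rintro ⟨a, rfl⟩
    exact tmul_mem_cochainsDeg (form_mul_mem _ (form_mul_mem _ (form_mem _))) a

theorem eq_zero_of_mem_cochainsDeg {n : ℕ} {u : Cochains SL2 A}
    (h : u ∈ cochainsDeg SL2 A (n + 4)) : u = 0 := by
  refine cochainsDeg_le (S := ⊥) (fun ω hω a => ?_) h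
  obtain rfl : ω = 0 := mem_monomialSpan hω
  exact TensorProduct.zero_tmul _ _

/-- Every cochain is a sum of cochains of degrees `0, 1, 2, 3`. -/
theorem exists_cochain (u : Cochains SL2 A) : ∃ a a₀ a₁ a₂ b₀ b₁ b₂ c,
    u = cochain0 a + cochain1 a₀ a₁ a₂ + cochain2 b₀ b₁ b₂ + cochain3 c := by
  induction u using TensorProduct.induction_on with
  | zero => exact ⟨0, 0, 0, 0, 0, 0, 0, 0, by
      simp [cochain0_zero, cochain1_zero, cochain2_zero, cochain3_zero]⟩
  | add u v hu hv =>
    obtain ⟨a, a₀, a₁, a₂, b₀, b₁, b₂, c, rfl⟩ := hu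
    obtain ⟨a', a₀', a₁', a₂', b₀', b₁', b₂', c', rfl⟩ := hv
    refine ⟨a + a', a₀ + a₀', a₁ + a₁', a₂ + a₂', b₀ + b₀', b₁ + b₁', b₂ + b₂', c + c', ?_⟩
    rw [cochain0_add, cochain1_add, cochain2_add, cochain3_add]
    abel
  | tmul ω a =>
    induction ω using DirectSum.Decomposition.inductionOn
      (fun n : ℕ => ⋀[ℂ]^n (Module.Dual ℂ SL2)) with
    | zero => exact ⟨0, 0, 0, 0, 0, 0, 0, 0, by
        simp [cochain0_zero, cochain1_zero, cochain2_zero, cochain3_zero]⟩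
    | add ω η hω hη =>
      obtain ⟨a, a₀, a₁, a₂, b₀, b₁, b₂, c, hω⟩ := hω
      obtain ⟨a', a₀', a₁', a₂', b₀', b₁', b₂', c', hη⟩ := hη
      refine ⟨a + a', a₀ + a₀', a₁ + a₁', a₂ + a₂', b₀ + b₀', b₁ + b₁', b₂ + b₂', c + c', ?_⟩
      rw [TensorProduct.add_tmul, hω, hη, cochain0_add, cochain1_add, cochain2_add, cochain3_add]
      abel
    | @homogeneous n ω =>
      have h := tmul_mem_cochainsDeg ω.2 a
      match n with
      | 0 =>
        obtain ⟨a, h⟩ := mem_cochainsDeg_zero.1 h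
        exact ⟨a, 0, 0, 0, 0, 0, 0, 0, by simp [h, cochain1_zero, cochain2_zero, cochain3_zero]⟩
      | 1 =>
        obtain ⟨a, b, c, h⟩ := mem_cochainsDeg_one.1 h
        exact ⟨0, a, b, c, 0, 0, 0, 0, by simp [h, cochain0_zero, cochain2_zero, cochain3_zero]⟩
      | 2 =>
        obtain ⟨a, b, c, h⟩ := mem_cochainsDeg_two.1 h
        exact ⟨0, 0, 0, 0, a, b, c, 0, by simp [h, cochain0_zero, cochain1_zero, cochain3_zero]⟩
      | 3 =>
        obtain ⟨a, h⟩ := mem_cochainsDeg_three.1 h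
        exact ⟨0, 0, 0, 0, 0, 0, 0, a, by simp [h, cochain0_zero, cochain1_zero, cochain2_zero]⟩
      | n + 4 =>
        exact ⟨0, 0, 0, 0, 0, 0, 0, 0, by
          simp [eq_zero_of_mem_cochainsDeg h, cochain0_zero, cochain1_zero, cochain2_zero,
            cochain3_zero]⟩

end SL2

namespace Target

/-- The standard generators of the exterior algebra of `ℂ²`. -/
def gen (i : Fin 2) : ExteriorAlgebra ℂ (Fin 2 → ℂ) := ExteriorAlgebra.ι ℂ (Pi.single i 1)

theorem gen_sq (i : Fin 2) : gen i * gen i = 0 := ExteriorAlgebra.ι_sq_zero _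

theorem gen_swap : gen 1 * gen 0 = -(gen 0 * gen 1) :=
  eq_neg_of_add_eq_zero_left (ExteriorAlgebra.ι_add_mul_swap _ _)

theorem iota_eq (v : Fin 2 → ℂ) : ExteriorAlgebra.ι ℂ v = v 0 • gen 0 + v 1 • gen 1 := by
  simp only [gen, ← map_smul, ← map_add]
  congr 1
  ext i
  fin_cases i <;> simp

/-- The span of the monomials of degree `n` in the generators. -/
def monomialSpan : ℕ → Submodule ℂ (ExteriorAlgebra ℂ (Fin 2 → ℂ))
  | 0 => Submodule.span ℂ {1}
  | 1 => Submodule.span ℂ {gen 0, gen 1}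
  | 2 => Submodule.span ℂ {gen 0 * gen 1}
  | _ => ⊥

theorem mem_monomialSpan {n : ℕ} {ω : ExteriorAlgebra ℂ (Fin 2 → ℂ)}
    (h : ω ∈ ⋀[ℂ]^n (Fin 2 → ℂ)) : ω ∈ monomialSpan n := by
  rw [ExteriorAlgebra.exteriorPower] at h
  induction n generalizing ω with
  | zero =>
    rw [pow_zero, Submodule.one_eq_span] at h
    exact h
  | succ n ih =>
    rw [pow_succ'] at h
    induction h using Submodule.mul_induction_on' with
    | mem_mul_mem η hη θ hθ =>
      obtain ⟨v, rfl⟩ := hη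
      have hθ := ih hθ
      rw [iota_eq]
      match n with
      | 0 =>
        obtain ⟨c, rfl⟩ := Submodule.mem_span_singleton.1 hθ
        exact Submodule.mem_span_pair.2 ⟨c * v 0, c * v 1, by
          simp only [mul_smul_comm, mul_one]; module⟩
      | 1 =>
        obtain ⟨p, q, rfl⟩ := Submodule.mem_span_pair.1 hθ
        exact Submodule.mem_span_singleton.2 ⟨v 0 * q - v 1 * p, by
          simp only [add_mul, mul_add, smul_mul_smul_comm, gen_sq, gen_swap]; module⟩
      | 2 =>
        obtain ⟨p, rfl⟩ := Submodule.mem_span_singleton.1 hθ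
        change _ = 0
        simp only [add_mul, smul_mul_smul_comm, ← mul_assoc, gen_sq, gen_swap, neg_mul]
        simp [mul_assoc, gen_sq]
      | n + 3 =>
        obtain rfl : θ = 0 := hθ
        rw [mul_zero]
        exact zero_mem _
    | add η _ θ _ h1 h2 => exact add_mem h1 h2

theorem tmul_mem_targetDeg {n : ℕ} {ω : ExteriorAlgebra ℂ (Fin 2 → ℂ)}
    (h : ω ∈ ⋀[ℂ]^n (Fin 2 → ℂ)) (r : weylInvariants) : r ⊗ₜ[ℂ] ω ∈ targetDeg n :=
  ⟨r ⊗ₜ (⟨ω, h⟩ : ⋀[ℂ]^n (Fin 2 → ℂ)), by simp⟩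

theorem targetDeg_le {n : ℕ} {S : AddSubmonoid Target}
    (h : ∀ ω ∈ ⋀[ℂ]^n (Fin 2 → ℂ), ∀ r : weylInvariants, r ⊗ₜ[ℂ] ω ∈ S) {u : Target}
    (hu : u ∈ targetDeg n) : u ∈ S := by
  obtain ⟨w, rfl⟩ := hu
  induction w using TensorProduct.induction_on with
  | zero => rw [map_zero]; exact zero_mem _
  | add v w hv hw => rw [map_add]; exact add_mem hv hw
  | tmul r ω => exact h ω ω.2 r

theorem gen_mem (i : Fin 2) : gen i ∈ ⋀[ℂ]^1 (Fin 2 → ℂ) := by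
  rw [ExteriorAlgebra.exteriorPower, pow_one]
  exact ⟨_, rfl⟩

theorem gen_mul_gen_mem (i j : Fin 2) : gen i * gen j ∈ ⋀[ℂ]^2 (Fin 2 → ℂ) := by
  rw [ExteriorAlgebra.exteriorPower, pow_two]
  exact Submodule.mul_mem_mul ⟨_, rfl⟩ ⟨_, rfl⟩

theorem mem_targetDeg_zero {u : Target} : u ∈ targetDeg 0 ↔ ∃ r, u = r ⊗ₜ 1 := by
  refine ⟨targetDeg_le (S := ⟨⟨{u | ∃ r, u = r ⊗ₜ 1}, ?_⟩, 0, (TensorProduct.zero_tmul _ _).symm⟩)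
    ?_, ?_⟩
  · rintro _ _ ⟨a, rfl⟩ ⟨b, rfl⟩
    exact ⟨a + b, (TensorProduct.add_tmul _ _ _).symm⟩
  · intro ω hω a
    obtain ⟨c, rfl⟩ := Submodule.mem_span_singleton.1 (mem_monomialSpan hω)
    exact ⟨c • a, (TensorProduct.smul_tmul _ _ _).symm⟩
  · rintro ⟨a, rfl⟩
    refine tmul_mem_targetDeg ?_ a
    rw [ExteriorAlgebra.exteriorPower, pow_zero]
    exact Submodule.one_le.1 le_rfl

theorem mem_targetDeg_one {u : Target} :
    u ∈ targetDeg 1 ↔ ∃ r s, u = r ⊗ₜ gen 0 + s ⊗ₜ gen 1 := by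
  refine ⟨targetDeg_le (S := ⟨⟨{u | ∃ r s, u = r ⊗ₜ gen 0 + s ⊗ₜ gen 1}, ?_⟩, 0, 0, by simp⟩)
    ?_, ?_⟩
  · rintro _ _ ⟨a, b, rfl⟩ ⟨a', b', rfl⟩
    exact ⟨a + a', b + b', by simp only [TensorProduct.add_tmul]; abel⟩
  · intro ω hω a
    obtain ⟨p, q, rfl⟩ := Submodule.mem_span_pair.1 (mem_monomialSpan hω)
    exact ⟨p • a, q • a, by simp [TensorProduct.tmul_add, TensorProduct.smul_tmul]⟩
  · rintro ⟨a, b, rfl⟩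
    exact add_mem (tmul_mem_targetDeg (gen_mem _) _) (tmul_mem_targetDeg (gen_mem _) _)

theorem mem_targetDeg_two {u : Target} : u ∈ targetDeg 2 ↔ ∃ r, u = r ⊗ₜ (gen 0 * gen 1) := by
  refine ⟨targetDeg_le (S := ⟨⟨{u | ∃ r, u = r ⊗ₜ (gen 0 * gen 1)}, ?_⟩, 0,
    (TensorProduct.zero_tmul _ _).symm⟩) ?_, ?_⟩
  · rintro _ _ ⟨a, rfl⟩ ⟨b, rfl⟩
    exact ⟨a + b, (TensorProduct.add_tmul _ _ _).symm⟩
  · intro ω hω a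
    obtain ⟨c, rfl⟩ := Submodule.mem_span_singleton.1 (mem_monomialSpan hω)
    exact ⟨c • a, (TensorProduct.smul_tmul _ _ _).symm⟩
  · rintro ⟨a, rfl⟩
    exact tmul_mem_targetDeg (gen_mul_gen_mem _ _) a

theorem eq_zero_of_mem_targetDeg {n : ℕ} {u : Target} (h : u ∈ targetDeg (n + 3)) : u = 0 := by
  refine targetDeg_le (S := ⊥) (fun ω hω a => ?_) h
  obtain rfl : ω = 0 := mem_monomialSpan hω
  exact TensorProduct.tmul_zero _ _

/-- Every element of the target is a sum of elements of degrees `0, 1, 2`. -/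
theorem exists_eq (u : Target) : ∃ r s t w,
    u = r ⊗ₜ 1 + (s ⊗ₜ gen 0 + t ⊗ₜ gen 1) + w ⊗ₜ (gen 0 * gen 1) := by
  induction u using TensorProduct.induction_on with
  | zero => exact ⟨0, 0, 0, 0, by simp⟩
  | add u v hu hv =>
    obtain ⟨a, b, c, d, rfl⟩ := hu
    obtain ⟨a', b', c', d', rfl⟩ := hv
    refine ⟨a + a', b + b', c + c', d + d', ?_⟩
    simp only [TensorProduct.add_tmul]
    abel
  | tmul a ω =>
    induction ω using DirectSum.Decomposition.inductionOn
      (fun n : ℕ => ⋀[ℂ]^n (Fin 2 → ℂ)) with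
    | zero => exact ⟨0, 0, 0, 0, by simp⟩
    | add ω η hω hη =>
      obtain ⟨a, b, c, d, hω⟩ := hω
      obtain ⟨a', b', c', d', hη⟩ := hη
      refine ⟨a + a', b + b', c + c', d + d', ?_⟩
      rw [TensorProduct.tmul_add, hω, hη]
      simp only [TensorProduct.add_tmul]
      abel
    | @homogeneous n ω =>
      have h := tmul_mem_targetDeg ω.2 a
      match n with
      | 0 =>
        obtain ⟨r, h⟩ := mem_targetDeg_zero.1 h
        exact ⟨r, 0, 0, 0, by simp [h]⟩
      | 1 =>
        obtain ⟨r, s, h⟩ := mem_targetDeg_one.1 h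
        exact ⟨0, r, s, 0, by simp [h]⟩
      | 2 =>
        obtain ⟨r, h⟩ := mem_targetDeg_two.1 h
        exact ⟨0, 0, 0, r, by simp [h]⟩
      | n + 3 => exact ⟨0, 0, 0, 0, by simp [eq_zero_of_mem_targetDeg h]⟩

end Target

/-! ## Cohomology of a free action of the Borel subalgebra -/

namespace SL2

open LieCohomology

section

variable {A : Type} [CommRing A] [Algebra ℂ A] (π : SL2 →ₗ⁅ℂ⁆ Derivation ℂ A A)

theorem h_e_apply (a : A) :
    π (basis 1) (π (basis 0) a) = π (basis 0) (π (basis 1) a) + (2 : ℂ) • π (basis 0) a := by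
  have h := congrArg (fun X => π X a) lie_basis.1
  simp only [LieHom.map_lie, Derivation.commutator_apply, map_smul, Derivation.smul_apply] at h
  rw [neg_smul] at h
  linear_combination -h

theorem e_f_apply (a : A) :
    π (basis 0) (π (basis 2) a) = π (basis 2) (π (basis 0) a) + π (basis 1) a := by
  have h := congrArg (fun X => π X a) lie_basis.2.1
  simp only [LieHom.map_lie, Derivation.commutator_apply] at h
  linear_combination h

theorem h_f_apply (a : A) :
    π (basis 1) (π (basis 2) a) = π (basis 2) (π (basis 1) a) - (2 : ℂ) • π (basis 2) a := by
  have h := congrArg (fun X => π X a) lie_basis.2.2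
  simp only [LieHom.map_lie, Derivation.commutator_apply, map_smul, Derivation.smul_apply] at h
  rw [neg_smul] at h
  linear_combination h

/-- An identification of `A` with `ℂ[P]^W[z, u, u⁻¹]` for which `e` acts as `∂/∂z`, `h` as
`2 (u ∂/∂u - z ∂/∂z)`, and `f` as `z h` on functions of `u`, expressed through its consequences. -/
structure Trivialization where
  const : weylInvariants →ₐ[ℂ] A
  z : A
  u : A
  v : A
  const_injective : Function.Injective const
  u_mul_v : u * v = 1
  e_z : π (basis 0) z = 1
  h_z : π (basis 1) z = -2 * z
  e_u : π (basis 0) u = 0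
  h_u : π (basis 1) u = 2 * u
  e_v : π (basis 0) v = 0
  h_v : π (basis 1) v = -2 * v
  e_const : ∀ r, π (basis 0) (const r) = 0
  h_const : ∀ r, π (basis 1) (const r) = 0
  f_of_e : ∀ k, π (basis 0) k = 0 → π (basis 2) k = z * π (basis 1) k
  e_surjective : ∀ a, ∃ c, π (basis 0) c = a
  exists_const_add : ∀ k, π (basis 0) k = 0 → ∃ r k', π (basis 0) k' = 0 ∧
    k = const r + π (basis 1) k'
  of_h_eq_const : ∀ k r, π (basis 0) k = 0 → π (basis 1) k = const r → r = 0 ∧ ∃ s, k = const s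

end

namespace Trivialization

variable {A : Type} [CommRing A] [Algebra ℂ A] {π : SL2 →ₗ⁅ℂ⁆ Derivation ℂ A A}
  (τ : Trivialization π)

theorem two_smul' (a : A) : (2 : ℂ) • a = 2 * a := by
  rw [two_smul, two_mul]

theorem f_const (r : weylInvariants) : π (basis 2) (τ.const r) = 0 := by
  rw [τ.f_of_e _ (τ.e_const r), τ.h_const, mul_zero]

theorem eq_of_cocycle0 {a : A} (h : differential basis π (cochain0 a) = 0) :
    ∃ r, a = τ.const r := by
  rw [differential_cochain0] at h
  obtain ⟨-, ⟨h0, h1, -⟩, -⟩ := cochain_eq_zero (a := (0 : A)) (b₀ := 0) (b₁ := 0) (b₂ := 0)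
    (c := 0) (by rw [h]; simp [cochain0_zero, cochain2_zero, cochain3_zero])
  exact (τ.of_h_eq_const a 0 h0 (by rw [h1, map_zero])).2

theorem exists_of_cocycle1 {a b c : A} (h : differential basis π (cochain1 a b c) = 0) :
    ∃ p r s, cochain1 a b c = differential basis π (cochain0 p) +
      cochain1 0 (τ.const r) (τ.const r * τ.z + τ.const s * τ.v) := by
  rw [differential_cochain1] at h
  obtain ⟨-, -, ⟨h0, h1, h2⟩, -⟩ := cochain_eq_zero (a := (0 : A)) (a₀ := 0) (a₁ := 0) (a₂ := 0)
    (c := 0) (by rw [h]; simp [cochain0_zero, cochain1_zero, cochain3_zero])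
  simp only [two_smul'] at h0 h1 h2
  obtain ⟨p, rfl⟩ := τ.e_surjective a
  have he := h_e_apply π p
  have hf := h_f_apply π p
  have ef := e_f_apply π p
  simp only [two_smul'] at he hf
  obtain ⟨r, k, hk, hrk⟩ := τ.exists_const_add (b - π (basis 1) p) (by
    rw [map_sub]; linear_combination h0 + he)
  have hb : b = τ.const r + π (basis 1) (p + k) := by rw [map_add]; linear_combination hrk
  have hek := h_e_apply π k
  have hfk := h_f_apply π k
  have hF := τ.f_of_e k hk
  rw [two_smul', hk, map_zero] at hek
  rw [two_smul'] at hfk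
  have hfb : π (basis 2) b = π (basis 2) (π (basis 1) p) + π (basis 2) (π (basis 1) k) := by
    rw [hb, map_add, map_add, map_add, τ.f_const, zero_add]
  have heh : π (basis 0) (π (basis 1) k) = 0 := by linear_combination -hek
  obtain ⟨-, s, hs⟩ := τ.of_h_eq_const
    (τ.u * (c - π (basis 2) (p + k) - τ.const r * τ.z)) 0 (by
      simp only [Derivation.leibniz, map_sub, map_add, smul_eq_mul, τ.e_u, τ.e_z, τ.e_const, hF,
        heh]
      rw [map_add] at hb
      linear_combination τ.u * (h1 - ef + hb))
    (by
      simp only [Derivation.leibniz, map_sub, map_add, smul_eq_mul, τ.h_u, τ.h_z, τ.h_const, map_zero]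
      linear_combination τ.u * (h2 + hfb - hf - hfk))
  have hc : c = π (basis 2) (p + k) + (τ.const r * τ.z + τ.const s * τ.v) := by
    rw [← hs]
    linear_combination (c - π (basis 2) (p + k) - τ.const r * τ.z) * (-τ.u_mul_v)
  refine ⟨p + k, r, s, ?_⟩
  rw [differential_cochain0, ← cochain1_add, ← hc, map_add, hk, add_zero, add_zero,
    add_comm (π (basis 1) (p + k)), ← hb]

theorem exists_of_cocycle2 {a b c : A} (h : differential basis π (cochain2 a b c) = 0) :
    ∃ q w s, cochain2 a b c = differential basis π (cochain1 0 q w) +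
      cochain2 0 0 (τ.const s * τ.v) := by
  rw [differential_cochain2] at h
  obtain ⟨-, -, -, h⟩ := cochain_eq_zero (a := (0 : A)) (a₀ := 0) (a₁ := 0) (a₂ := 0)
    (b₀ := 0) (b₁ := 0) (b₂ := 0) (by rw [h]; simp [cochain0_zero, cochain1_zero, cochain2_zero])
  obtain ⟨q, rfl⟩ := τ.e_surjective a
  obtain ⟨w, hw⟩ := τ.e_surjective (b + q)
  have he := h_e_apply π w
  have ef := e_f_apply π q
  rw [two_smul', hw, map_add] at he
  obtain ⟨s, k, hk, hsk⟩ := τ.exists_const_add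
    (τ.u * (c - (π (basis 1) w - π (basis 2) q + 2 * w))) (by
      rw [← two_smul']
      simp only [Derivation.leibniz, map_sub, map_add, smul_eq_mul, τ.e_u, Derivation.map_smul, hw]
      rw [two_smul']
      linear_combination τ.u * (h + he + ef))
  have hc : c = π (basis 1) (w + τ.v * k) - π (basis 2) q + 2 * (w + τ.v * k) +
      τ.const s * τ.v := by
    simp only [Derivation.leibniz, map_add, smul_eq_mul, τ.h_v]
    linear_combination τ.v * hsk -
      (c - (π (basis 1) w - π (basis 2) q + 2 * w)) * τ.u_mul_v
  refine ⟨q, w + τ.v * k, s, ?_⟩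
  rw [differential_cochain1, ← cochain2_add, two_smul', two_smul', ← hc]
  congr 1
  · simp
  · simp [hw, hk, τ.e_v]

theorem exists_of_cochain3 (τ : Trivialization π) (a : A) :
    ∃ c, cochain3 a = differential basis π (cochain2 0 0 c) := by
  obtain ⟨c, rfl⟩ := τ.e_surjective a
  exact ⟨c, by rw [differential_cochain2, map_zero (π _), map_zero (π _), sub_zero, add_zero]⟩

theorem eq_zero_of_coboundary {u : Cochains SL2 A} {r s t w : weylInvariants}
    (h : differential basis π u = cochain0 (τ.const r) +
      cochain1 0 (τ.const s) (τ.const s * τ.z + τ.const t * τ.v) +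
      cochain2 0 0 (τ.const w * τ.v)) : r = 0 ∧ s = 0 ∧ t = 0 ∧ w = 0 := by
  have hv {t : weylInvariants} (h : τ.const t * τ.v = 0) : t = 0 := by
    apply τ.const_injective
    rw [map_zero]
    linear_combination τ.u * h - τ.const t * τ.u_mul_v
  obtain ⟨a, p, q, x, b₀, b₁, b₂, c, rfl⟩ := exists_cochain u
  simp only [map_add, differential_cochain0, differential_cochain1, differential_cochain2,
    differential_cochain3] at h
  obtain ⟨hr, ⟨h0, h1, h2⟩, ⟨g0, g1, g2⟩, -⟩ := cochain_eq_zero (a := τ.const r)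
    (a₀ := -π (basis 0) a) (a₁ := τ.const s - π (basis 1) a)
    (a₂ := τ.const s * τ.z + τ.const t * τ.v - π (basis 2) a)
    (b₀ := -(π (basis 0) q - π (basis 1) p + (2 : ℂ) • p))
    (b₁ := -(π (basis 0) x - π (basis 2) p - q))
    (b₂ := τ.const w * τ.v - (π (basis 1) x - π (basis 2) q + (2 : ℂ) • x))
    (c := -(π (basis 0) b₂ - π (basis 1) b₁ + π (basis 2) b₀)) (by
      have e := sub_eq_zero.2 h.symm
      rw [← e]
      simp only [cochain0, cochain1, cochain2, cochain3, TensorProduct.tmul_sub,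
        TensorProduct.tmul_neg, TensorProduct.tmul_zero]
      abel)
  have ha := neg_eq_zero.1 h0
  obtain ⟨rfl, -⟩ := τ.of_h_eq_const a s ha (sub_eq_zero.1 h1).symm
  rw [map_zero, zero_sub, neg_eq_zero] at h1
  rw [τ.f_of_e a ha, h1, map_zero] at h2
  refine ⟨τ.const_injective (by rw [hr, map_zero]), rfl, hv (by linear_combination h2), ?_⟩
  obtain ⟨p, rfl⟩ := τ.e_surjective p
  have he := h_e_apply π p
  have hf := h_f_apply π p
  have ef := e_f_apply π p
  simp only [two_smul'] at he hf g0 g1 g2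
  have hq : π (basis 0) (q - π (basis 1) p) = 0 := by
    rw [map_sub]; linear_combination he - g0
  have hq' := τ.f_of_e _ hq
  simp only [map_sub] at hq' hq
  refine (τ.of_h_eq_const (τ.u * (x - π (basis 2) p - τ.z * (q - π (basis 1) p))) w ?_ ?_).1
  · simp only [Derivation.leibniz, map_sub, smul_eq_mul, τ.e_u, τ.e_z]
    linear_combination τ.u * (-g1 - ef - τ.z * hq)
  · simp only [Derivation.leibniz, map_sub, smul_eq_mul, τ.h_u, τ.h_z]
    linear_combination τ.u * (-g2 + hq' - hf) + τ.const w * τ.u_mul_v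

end Trivialization

end SL2

/-! ## The isomorphism -/

namespace SL2

open LieCohomology

namespace Trivialization

variable {A : Type} [CommRing A] [Algebra ℂ A] {π : SL2 →ₗ⁅ℂ⁆ Derivation ℂ A A}

theorem cochain0_mul (a b c d : A) :
    cochain0 a * cochain0 b = cochain0 (a * b) ∧
      cochain0 a * cochain1 b c d = cochain1 (a * b) (a * c) (a * d) ∧
      cochain0 a * cochain2 b c d = cochain2 (a * b) (a * c) (a * d) := by
  simp [cochain0, cochain1, cochain2, mul_add]

variable (τ : Trivialization π)

theorem const_mem (r : weylInvariants) : cochain0 (τ.const r) ∈ cocycles basis π := by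
  change differential basis π _ = 0
  rw [differential_cochain0, τ.e_const, τ.h_const, τ.f_const, cochain1_zero]

theorem cochain1_mem (r s : weylInvariants) :
    cochain1 0 (τ.const r) (τ.const r * τ.z + τ.const s * τ.v) ∈ cocycles basis π := by
  change differential basis π _ = 0
  rw [differential_cochain1]
  simp only [map_add, Derivation.leibniz, smul_eq_mul, τ.e_const, τ.h_const, τ.f_const, τ.e_z,
    τ.h_z, τ.e_v, τ.h_v, map_zero, smul_zero, two_smul']
  rw [← cochain2_zero]
  congr 1 <;> ring

/-- The cocycles attached to functions in `ℂ[P]^W`. -/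
def constCocycle : weylInvariants →ₐ[ℂ] cocycles basis π :=
  (Algebra.TensorProduct.includeRight.comp τ.const).codRestrict _ τ.const_mem

/-- The two generating cocycles of degree one. -/
def genCocycle (i : Fin 2) : cocycles basis π :=
  ⟨cochain1 0 (τ.const (if i = 0 then 1 else 0))
    (τ.const (if i = 0 then 1 else 0) * τ.z + τ.const (if i = 0 then 0 else 1) * τ.v),
    τ.cochain1_mem _ _⟩

theorem coe_genCocycle : (τ.genCocycle 0 : Cochains SL2 A) = cochain1 0 1 τ.z ∧
    (τ.genCocycle 1 : Cochains SL2 A) = cochain1 0 0 τ.v := by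
  simp [genCocycle]

theorem genCocycle_mul : τ.genCocycle 0 * τ.genCocycle 0 = 0 ∧
    τ.genCocycle 1 * τ.genCocycle 1 = 0 ∧
    τ.genCocycle 1 * τ.genCocycle 0 = -(τ.genCocycle 0 * τ.genCocycle 1) ∧
    (τ.genCocycle 0 * τ.genCocycle 1 : Cochains SL2 A) = cochain2 0 0 τ.v := by
  obtain ⟨h0, h1⟩ := τ.coe_genCocycle
  refine ⟨Subtype.ext ?_, Subtype.ext ?_, Subtype.ext ?_, ?_⟩ <;>
  simp [h0, h1, cochain1, cochain2, mul_add, add_mul, form_sq, form_swap 1 2,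
    TensorProduct.neg_tmul]

/-- The algebra homomorphism from the exterior algebra of `ℂ²` to the cocycles. -/
def exteriorCocycle : ExteriorAlgebra ℂ (Fin 2 → ℂ) →ₐ[ℂ] cocycles basis π :=
  ExteriorAlgebra.lift ℂ ⟨(LinearMap.proj 0).smulRight (τ.genCocycle 0) +
    (LinearMap.proj 1).smulRight (τ.genCocycle 1), fun v => by
      obtain ⟨h1, h2, h3, -⟩ := τ.genCocycle_mul
      simp only [LinearMap.add_apply, LinearMap.smulRight_apply, add_mul, mul_add,
        smul_mul_smul_comm, h1, h2, h3]
      module⟩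

theorem exteriorCocycle_gen (i : Fin 2) : τ.exteriorCocycle (Target.gen i) = τ.genCocycle i := by
  rw [Target.gen, exteriorCocycle, ExteriorAlgebra.lift_ι_apply]
  fin_cases i <;> simp

theorem commute_constCocycle (r : weylInvariants) (c : cocycles basis π) :
    Commute (τ.constCocycle r) c := by
  refine Subtype.ext ?_
  change (1 ⊗ₜ τ.const r : Cochains SL2 A) * _ = _ * (1 ⊗ₜ τ.const r)
  generalize (c : Cochains SL2 A) = u
  induction u using TensorProduct.induction_on with
  | zero => simp
  | add u v hu hv => rw [mul_add, add_mul, hu, hv]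
  | tmul η a =>
    rw [Algebra.TensorProduct.tmul_mul_tmul, Algebra.TensorProduct.tmul_mul_tmul, one_mul,
      mul_one, mul_comm]

/-- The algebra homomorphism from `ℂ[P]^W ⊗ ⋀ ℂ²` to the cocycles. -/
def targetCocycle : Target →ₐ[ℂ] cocycles basis π :=
  Algebra.TensorProduct.lift τ.constCocycle τ.exteriorCocycle fun _ _ =>
    τ.commute_constCocycle _ _

theorem coe_targetCocycle_tmul (r : weylInvariants) (ω : ExteriorAlgebra ℂ (Fin 2 → ℂ)) :
    (τ.targetCocycle (r ⊗ₜ ω) : Cochains SL2 A) = cochain0 (τ.const r) * τ.exteriorCocycle ω := by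
  rw [targetCocycle, Algebra.TensorProduct.lift_tmul]
  rfl

theorem coe_targetCocycle_zero (r : weylInvariants) :
    (τ.targetCocycle (r ⊗ₜ 1) : Cochains SL2 A) = cochain0 (τ.const r) := by
  rw [coe_targetCocycle_tmul, map_one]
  exact mul_one _

theorem coe_targetCocycle_one (r s : weylInvariants) :
    (τ.targetCocycle (r ⊗ₜ Target.gen 0 + s ⊗ₜ Target.gen 1) : Cochains SL2 A) =
      cochain1 0 (τ.const r) (τ.const r * τ.z + τ.const s * τ.v) := by
  obtain ⟨h0, h1⟩ := τ.coe_genCocycle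
  rw [map_add, Subalgebra.coe_add, coe_targetCocycle_tmul, coe_targetCocycle_tmul,
    exteriorCocycle_gen, exteriorCocycle_gen, h0, h1, (cochain0_mul _ _ _ _).2.1,
    (cochain0_mul _ _ _ _).2.1, ← cochain1_add]
  simp

theorem coe_targetCocycle_two (r : weylInvariants) :
    (τ.targetCocycle (r ⊗ₜ (Target.gen 0 * Target.gen 1)) : Cochains SL2 A) =
      cochain2 0 0 (τ.const r * τ.v) := by
  rw [coe_targetCocycle_tmul, map_mul, exteriorCocycle_gen, exteriorCocycle_gen,
    Subalgebra.coe_mul, τ.genCocycle_mul.2.2.2, (cochain0_mul _ _ _ _).2.2, mul_zero]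

/-- The algebra homomorphism from `ℂ[P]^W ⊗ ⋀ ℂ²` to the cohomology. -/
def toCohomology : Target →ₐ[ℂ] Cohomology basis π :=
  (Ideal.Quotient.mkₐ ℂ (coboundaries basis π)).comp τ.targetCocycle

theorem toCohomology_injective : Function.Injective τ.toCohomology := by
  rw [injective_iff_map_eq_zero]
  intro x hx
  obtain ⟨u, hu⟩ := Ideal.Quotient.eq_zero_iff_mem.1 hx
  have hu : differential basis π u = (τ.targetCocycle x : Cochains SL2 A) := hu
  obtain ⟨r, s, t, w, rfl⟩ := Target.exists_eq x
  rw [map_add, map_add, Subalgebra.coe_add, Subalgebra.coe_add, coe_targetCocycle_zero,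
    coe_targetCocycle_one, coe_targetCocycle_two] at hu
  obtain ⟨rfl, rfl, rfl, rfl⟩ := τ.eq_zero_of_coboundary hu
  simp

theorem mk_eq_toCohomology {c : Cochains SL2 A} (hc : c ∈ cocycles basis π) {x : Target}
    (u : Cochains SL2 A)
    (h : c = differential basis π u + (τ.targetCocycle x : Cochains SL2 A)) :
    Ideal.Quotient.mkₐ ℂ (coboundaries basis π) ⟨c, hc⟩ = τ.toCohomology x := by
  refine Ideal.Quotient.eq.2 ⟨u, ?_⟩
  change _ = c - (τ.targetCocycle x : Cochains SL2 A)
  rw [h, add_sub_cancel_right]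

theorem exists_toCohomology_eq_zero {a : A} (h : cochain0 a ∈ cocycles basis π) :
    ∃ x ∈ targetDeg 0,
      Ideal.Quotient.mkₐ ℂ (coboundaries basis π) ⟨cochain0 a, h⟩ = τ.toCohomology x := by
  obtain ⟨r, hr⟩ := τ.eq_of_cocycle0 h
  refine ⟨r ⊗ₜ 1, Target.mem_targetDeg_zero.2 ⟨r, rfl⟩, τ.mk_eq_toCohomology h 0 ?_⟩
  rw [coe_targetCocycle_zero, map_zero, zero_add, hr]

theorem exists_toCohomology_eq_one {a b c : A} (h : cochain1 a b c ∈ cocycles basis π) :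
    ∃ x ∈ targetDeg 1,
      Ideal.Quotient.mkₐ ℂ (coboundaries basis π) ⟨cochain1 a b c, h⟩ = τ.toCohomology x := by
  obtain ⟨p, r, s, hr⟩ := τ.exists_of_cocycle1 h
  refine ⟨r ⊗ₜ Target.gen 0 + s ⊗ₜ Target.gen 1, Target.mem_targetDeg_one.2 ⟨r, s, rfl⟩,
    τ.mk_eq_toCohomology h (cochain0 p) ?_⟩
  rw [coe_targetCocycle_one, hr]

theorem exists_toCohomology_eq_two {a b c : A} (h : cochain2 a b c ∈ cocycles basis π) :
    ∃ x ∈ targetDeg 2,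
      Ideal.Quotient.mkₐ ℂ (coboundaries basis π) ⟨cochain2 a b c, h⟩ = τ.toCohomology x := by
  obtain ⟨q, w, s, hr⟩ := τ.exists_of_cocycle2 h
  refine ⟨s ⊗ₜ (Target.gen 0 * Target.gen 1), Target.mem_targetDeg_two.2 ⟨s, rfl⟩,
    τ.mk_eq_toCohomology h (cochain1 0 q w) ?_⟩
  rw [coe_targetCocycle_two, hr]

theorem mk_cochain3 {a : A} (h : cochain3 a ∈ cocycles basis π) :
    Ideal.Quotient.mkₐ ℂ (coboundaries basis π) ⟨cochain3 a, h⟩ = τ.toCohomology 0 := by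
  obtain ⟨b, hb⟩ := τ.exists_of_cochain3 a
  refine τ.mk_eq_toCohomology h (cochain2 0 0 b) ?_
  rw [map_zero, hb]
  exact (add_zero _).symm

/-- Each homogeneous cocycle is cohomologous to the image of a homogeneous element. -/
theorem exists_toCohomology_eq {n : ℕ} (c : Cochains SL2 A) (hd : c ∈ cocycles basis π)
    (hc : c ∈ cochainsDeg SL2 A n) :
    ∃ x ∈ targetDeg n,
      Ideal.Quotient.mkₐ ℂ (coboundaries basis π) ⟨c, hd⟩ = τ.toCohomology x := by
  match n with
  | 0 =>
    obtain ⟨a, rfl⟩ := mem_cochainsDeg_zero.1 hc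
    exact τ.exists_toCohomology_eq_zero hd
  | 1 =>
    obtain ⟨a₀, a₁, a₂, rfl⟩ := mem_cochainsDeg_one.1 hc
    exact τ.exists_toCohomology_eq_one hd
  | 2 =>
    obtain ⟨b₀, b₁, b₂, rfl⟩ := mem_cochainsDeg_two.1 hc
    exact τ.exists_toCohomology_eq_two hd
  | 3 =>
    obtain ⟨a, rfl⟩ := mem_cochainsDeg_three.1 hc
    exact ⟨0, zero_mem _, τ.mk_cochain3 hd⟩
  | n + 4 =>
    obtain rfl := eq_zero_of_mem_cochainsDeg hc
    refine ⟨0, zero_mem _, τ.mk_eq_toCohomology hd 0 ?_⟩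
    rw [map_zero, map_zero]
    exact (add_zero _).symm

theorem targetCocycle_mem {n : ℕ} {x : Target} (hx : x ∈ targetDeg n) :
    (τ.targetCocycle x : Cochains SL2 A) ∈ cochainsDeg SL2 A n := by
  match n with
  | 0 =>
    obtain ⟨r, rfl⟩ := Target.mem_targetDeg_zero.1 hx
    exact mem_cochainsDeg_zero.2 ⟨_, τ.coe_targetCocycle_zero r⟩
  | 1 =>
    obtain ⟨r, s, rfl⟩ := Target.mem_targetDeg_one.1 hx
    exact mem_cochainsDeg_one.2 ⟨_, _, _, τ.coe_targetCocycle_one r s⟩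
  | 2 =>
    obtain ⟨r, rfl⟩ := Target.mem_targetDeg_two.1 hx
    exact mem_cochainsDeg_two.2 ⟨_, _, _, τ.coe_targetCocycle_two r⟩
  | n + 3 =>
    obtain rfl := Target.eq_zero_of_mem_targetDeg hx
    rw [map_zero]
    exact zero_mem _

theorem map_toCohomology (n : ℕ) :
    (targetDeg n).map τ.toCohomology.toLinearMap = cohomologyDeg basis π n := by
  apply le_antisymm
  · rintro _ ⟨x, hx, rfl⟩
    exact ⟨τ.targetCocycle x, τ.targetCocycle_mem hx, rfl⟩
  · rintro _ ⟨c, hc, rfl⟩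
    obtain ⟨x, hx, h⟩ := τ.exists_toCohomology_eq c c.2 hc
    exact ⟨x, hx, h.symm⟩

theorem exists_differential_add (c : Cochains SL2 A) (hd : differential basis π c = 0) :
    ∃ u x, c = differential basis π u + (τ.targetCocycle x : Cochains SL2 A) := by
  obtain ⟨a, a₀, a₁, a₂, b₀, b₁, b₂, b, rfl⟩ := exists_cochain c
  have hd' := hd
  simp only [map_add, differential_cochain0, differential_cochain1, differential_cochain2,
    differential_cochain3, add_zero] at hd'
  obtain ⟨-, ⟨h0, h1, h2⟩, ⟨g0, g1, g2⟩, h3⟩ := cochain_eq_zero (a := (0 : A))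
    (by rw [cochain0_zero, zero_add]; exact hd')
  obtain ⟨r, rfl⟩ := τ.eq_of_cocycle0 (a := a) (by
    rw [differential_cochain0, h0, h1, h2, cochain1_zero])
  obtain ⟨p, s, t, hp⟩ := τ.exists_of_cocycle1 (a := a₀) (b := a₁) (c := a₂) (by
    rw [differential_cochain1, g0, g1, g2, cochain2_zero])
  obtain ⟨q, q', w, hq⟩ := τ.exists_of_cocycle2 (a := b₀) (b := b₁) (c := b₂) (by
    rw [differential_cochain2, h3, cochain3_zero])
  obtain ⟨y, hy⟩ := τ.exists_of_cochain3 b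
  refine ⟨cochain0 p + cochain1 0 q q' + cochain2 0 0 y, r ⊗ₜ 1 +
    (s ⊗ₜ Target.gen 0 + t ⊗ₜ Target.gen 1) + w ⊗ₜ (Target.gen 0 * Target.gen 1), ?_⟩
  rw [map_add τ.targetCocycle, map_add τ.targetCocycle, Subalgebra.coe_add, Subalgebra.coe_add,
    coe_targetCocycle_zero, coe_targetCocycle_one, coe_targetCocycle_two, hp, hq, hy, map_add,
    map_add]
  abel

theorem toCohomology_surjective : Function.Surjective τ.toCohomology := by
  intro y
  obtain ⟨c, rfl⟩ := Ideal.Quotient.mkₐ_surjective ℂ (coboundaries basis π) y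
  obtain ⟨u, x, h⟩ := τ.exists_differential_add c c.2
  exact ⟨x, (τ.mk_eq_toCohomology c.2 u h).symm⟩

/-- The cohomology algebra is `ℂ[P]^W ⊗ ⋀ ℂ²`. -/
def cohomologyEquiv : Cohomology basis π ≃ₐ[ℂ] Target :=
  (AlgEquiv.ofBijective τ.toCohomology
    ⟨τ.toCohomology_injective, τ.toCohomology_surjective⟩).symm

theorem map_cohomologyEquiv (n : ℕ) :
    (cohomologyDeg basis π n).map τ.cohomologyEquiv.toLinearMap = targetDeg n := by
  have h (x : Target) : τ.cohomologyEquiv (τ.toCohomology x) = x :=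
    (AlgEquiv.ofBijective τ.toCohomology
      ⟨τ.toCohomology_injective, τ.toCohomology_surjective⟩).symm_apply_apply x
  rw [← τ.map_toCohomology, ← Submodule.map_comp]
  convert Submodule.map_id _
  exact LinearMap.ext h

end Trivialization

/-- The first cohomology of `sl₂` with trivial coefficients vanishes. -/
theorem cohomologyDeg_one_trivial :
    cohomologyDeg basis (0 : SL2 →ₗ⁅ℂ⁆ Derivation ℂ ℂ ℂ) 1 = ⊥ := by
  have key (u : Cochains SL2 ℂ) (hu : u ∈ cochainsDeg SL2 ℂ 1)
      (hd : differential basis (0 : SL2 →ₗ⁅ℂ⁆ Derivation ℂ ℂ ℂ) u = 0) : u = 0 := by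
    obtain ⟨a, b, c, rfl⟩ := mem_cochainsDeg_one.1 hu
    rw [differential_cochain1] at hd
    obtain ⟨-, -, ⟨h0, h1, h2⟩, -⟩ := cochain_eq_zero (a := (0 : ℂ)) (a₀ := 0) (a₁ := 0)
      (a₂ := 0) (c := 0) (by rw [hd]; simp [cochain0_zero, cochain1_zero, cochain3_zero])
    simp only [LieHom.zero_apply, Derivation.zero_apply, sub_zero, zero_add, zero_sub,
      neg_eq_zero, smul_eq_mul, mul_eq_zero, two_ne_zero, false_or] at h0 h1 h2
    rw [h0, h1, h2, cochain1_zero]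
  rw [eq_bot_iff]
  rintro _ ⟨c, hc, rfl⟩
  have h : c = 0 := Subtype.ext (key c hc c.2)
  rw [Submodule.mem_bot, h, map_zero]

end SL2

/-! ## The big cell -/

namespace BigCell

open SL2

theorem diagonalAction_basis : diagonalAction (basis 0) = leftE + rightE ∧
    diagonalAction (basis 1) = leftH + rightH ∧ diagonalAction (basis 2) = leftF + rightF := by
  have h (X : SL2) : diagonalAction X =
      (X.val 0 1 • leftE + X.val 0 0 • leftH + X.val 1 0 • leftF) +
      (X.val 0 1 • rightE + X.val 0 0 • rightH + X.val 1 0 • rightF) := rfl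
  refine ⟨?_, ?_, ?_⟩ <;> rw [h] <;>
  simp [basis, coords, ofCoords, Module.Basis.coe_ofEquivFun]

/-- The constant function `1 / 2`. -/
def half : Functions := algebraMap ℂ Functions (1 / 2)

theorem two_mul_half : 2 * half = 1 := by
  rw [half, ← map_ofNat (algebraMap ℂ Functions) 2, ← map_mul]
  norm_num

/-- The trace function. -/
def trace : Functions := zeta 1 * (x + y)

/-- The coordinate along the orbits of `e`. -/
def z : Functions := half * (y - x)

section Action

local notation "dE" => diagonalAction (basis 0)
local notation "dH" => diagonalAction (basis 1)
local notation "dF" => diagonalAction (basis 2)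

theorem e_x : dE x = -1 := by
  simp [diagonalAction_basis, leftE, rightE, partialDeriv_x_x, partialDeriv_y_x]

theorem e_y : dE y = 1 := by
  simp [diagonalAction_basis, leftE, rightE, partialDeriv_x_y, partialDeriv_y_y]

theorem e_zeta (n : ℤ) : dE (zeta n) = 0 := by
  simp [diagonalAction_basis, leftE, rightE, partialDeriv_zeta]

theorem h_x : dH x = -2 * x := by
  simp [diagonalAction_basis, leftH, rightH, partialDeriv_x_x, partialDeriv_y_x, euler_x,
    two_smul]
  ring

theorem h_y : dH y = -2 * y := by
  simp [diagonalAction_basis, leftH, rightH, partialDeriv_x_y, partialDeriv_y_y, euler_y,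
    two_smul]
  ring

theorem h_zeta (n : ℤ) : dH (zeta n) = 2 * n * zeta n := by
  simp [diagonalAction_basis, leftH, rightH, partialDeriv_zeta, euler_zeta]
  ring

theorem f_x : dF x = x * x - zeta (-2) := by
  simp [diagonalAction_basis, leftF, rightF, partialDeriv_x_x, partialDeriv_y_x, euler_x]
  ring

theorem f_y : dF y = zeta (-2) - y * y := by
  simp [diagonalAction_basis, leftF, rightF, partialDeriv_x_y, partialDeriv_y_y, euler_y]
  ring

theorem f_zeta (n : ℤ) : dF (zeta n) = n * (y - x) * zeta n := by
  simp [diagonalAction_basis, leftF, rightF, partialDeriv_zeta, euler_zeta]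
  ring

theorem e_trace : dE trace = 0 := by
  simp [trace, e_x, e_y, e_zeta]

theorem h_trace : dH trace = 0 := by
  simp [trace, h_x, h_y, h_zeta]
  ring

theorem f_trace : dF trace = 0 := by
  simp [trace, f_x, f_y, f_zeta]
  ring

theorem derivation_half (D : Derivation ℂ Functions Functions) : D half = 0 :=
  D.map_algebraMap _

theorem e_z : dE z = 1 := by
  simp only [z, Derivation.leibniz, map_sub, e_x, e_y, derivation_half, smul_eq_mul]
  linear_combination two_mul_half

theorem h_z : dH z = -2 * z := by
  simp only [z, Derivation.leibniz, map_sub, h_x, h_y, derivation_half, smul_eq_mul]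
  ring

/-- Polynomials in the trace function. -/
def ofTrace : Polynomial ℂ →ₐ[ℂ] Functions := Polynomial.aeval trace

theorem derivation_ofTrace (D : Derivation ℂ Functions Functions) (h : D trace = 0)
    (p : Polynomial ℂ) : D (ofTrace p) = 0 := by
  rw [ofTrace, Derivation.map_aeval, h, smul_zero]

/-- The function `ζ` as a unit. -/
def zetaUnit : Functionsˣ where
  val := zeta 1
  inv := zeta (-1)
  val_inv := by rw [← zeta_add]; exact zeta_zero
  inv_val := by rw [← zeta_add]; exact zeta_zero

theorem zetaUnit_zpow (n : ℤ) : ((zetaUnit ^ n : Functionsˣ) : Functions) = zeta n := by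
  rcases Int.eq_nat_or_neg n with ⟨m, rfl | rfl⟩
  · rw [zpow_natCast, Units.val_pow_eq_pow_val]
    change zeta 1 ^ m = _
    rw [zeta, LaurentPolynomial.T_pow, mul_one, zeta]
  · rw [zpow_neg, zpow_natCast, ← inv_pow, Units.val_pow_eq_pow_val]
    change zeta (-1) ^ m = _
    rw [zeta, LaurentPolynomial.T_pow, mul_neg_one, zeta]

/-- Laurent polynomials over the polynomials in one variable. -/
abbrev InvariantModel : Type := LaurentPolynomial (Polynomial ℂ)

/-- The functions invariant under `e`, as Laurent polynomials in `ζ` over the polynomials in the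
trace. -/
def ofLaurent : InvariantModel →+* Functions :=
  LaurentPolynomial.eval₂ ofTrace.toRingHom zetaUnit

theorem ofLaurent_C (p : Polynomial ℂ) : ofLaurent (LaurentPolynomial.C p) = ofTrace p := by
  rw [ofLaurent, LaurentPolynomial.eval₂_C]; rfl

theorem ofLaurent_T (n : ℤ) : ofLaurent (LaurentPolynomial.T n) = zeta n := by
  rw [ofLaurent, LaurentPolynomial.eval₂_T, zetaUnit_zpow]

theorem ofLaurent_C_mul_T (p : Polynomial ℂ) (n : ℤ) :
    ofLaurent (LaurentPolynomial.C p * LaurentPolynomial.T n) = ofTrace p * zeta n := by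
  rw [map_mul, ofLaurent_C, ofLaurent_T]

theorem e_ofLaurent (l : InvariantModel) : dE (ofLaurent l) = 0 := by
  induction l using LaurentPolynomial.induction_on' with
  | add p q hp hq => rw [map_add, map_add, hp, hq, add_zero]
  | C_mul_T n p =>
    rw [ofLaurent_C_mul_T, Derivation.leibniz, derivation_ofTrace _ e_trace, e_zeta, smul_zero,
      smul_zero, add_zero]

theorem h_ofTrace_mul_zeta (p : Polynomial ℂ) (n : ℤ) :
    dH (ofTrace p * zeta n) = 2 * n * (ofTrace p * zeta n) := by
  rw [Derivation.leibniz, derivation_ofTrace _ h_trace, h_zeta, smul_zero, add_zero, smul_eq_mul]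
  ring

theorem f_ofLaurent (l : InvariantModel) :
    dF (ofLaurent l) = z * dH (ofLaurent l) := by
  induction l using LaurentPolynomial.induction_on' with
  | add p q hp hq => simp only [map_add, hp, hq, mul_add]
  | C_mul_T n p =>
    rw [ofLaurent_C_mul_T, h_ofTrace_mul_zeta, Derivation.leibniz, derivation_ofTrace _ f_trace,
      f_zeta, smul_zero, add_zero, smul_eq_mul, z]
    linear_combination (-(n : Functions) * (y - x) * ofTrace p * zeta n) * two_mul_half

theorem exists_h_ofLaurent (l : InvariantModel) :
    ∃ m : InvariantModel, dH (ofLaurent l) = ofLaurent m ∧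
      ∀ n, m.coeff n = 2 * n * l.coeff n := by
  induction l using LaurentPolynomial.induction_on' with
  | add p q hp hq =>
    obtain ⟨m, hm, hm'⟩ := hp
    obtain ⟨k, hk, hk'⟩ := hq
    refine ⟨m + k, by rw [map_add, map_add, map_add, hm, hk], fun n => ?_⟩
    rw [AddMonoidAlgebra.coeff_add, AddMonoidAlgebra.coeff_add, Finsupp.add_apply,
      Finsupp.add_apply, hm', hk', mul_add]
  | C_mul_T n p =>
    refine ⟨LaurentPolynomial.C (2 * n * p) * LaurentPolynomial.T n, ?_, fun k => ?_⟩
    · rw [ofLaurent_C_mul_T, ofLaurent_C_mul_T, h_ofTrace_mul_zeta, map_mul, map_mul, map_ofNat,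
        map_intCast]
      ring
    · rw [← LaurentPolynomial.single_eq_C_mul_T, ← LaurentPolynomial.single_eq_C_mul_T,
        AddMonoidAlgebra.coeff_single, AddMonoidAlgebra.coeff_single, Finsupp.single_apply,
        Finsupp.single_apply]
      split_ifs with h
      · rw [h]
      · rw [mul_zero]

theorem exists_ofTrace_add (l : InvariantModel) :
    ∃ (p : Polynomial ℂ) (k : InvariantModel),
      ofLaurent l = ofTrace p + dH (ofLaurent k) := by
  induction l using LaurentPolynomial.induction_on' with
  | add l m hl hm =>
    obtain ⟨p, k, hl⟩ := hl
    obtain ⟨q, j, hm⟩ := hm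
    refine ⟨p + q, k + j, ?_⟩
    rw [map_add, hl, hm, map_add, map_add, map_add]
    ring
  | C_mul_T n p =>
    by_cases hn : n = 0
    · refine ⟨p, 0, ?_⟩
      rw [ofLaurent_C_mul_T, hn, zeta_zero, map_zero, map_zero, mul_one, add_zero]
    · refine ⟨0, LaurentPolynomial.C (Polynomial.C (1 / (2 * n) : ℂ) * p) *
        LaurentPolynomial.T n, ?_⟩
      have h : 2 * (n : Functions) * algebraMap ℂ Functions (1 / (2 * n)) = 1 := by
        have hn' : (n : ℂ) ≠ 0 := Int.cast_ne_zero.2 hn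
        rw [← map_ofNat (algebraMap ℂ Functions) 2, ← map_intCast (algebraMap ℂ Functions),
          ← map_mul, ← map_mul, mul_one_div_cancel (mul_ne_zero two_ne_zero hn'), map_one]
      rw [ofLaurent_C_mul_T, ofLaurent_C_mul_T, h_ofTrace_mul_zeta, map_zero, zero_add, map_mul,
        ← Polynomial.algebraMap_eq, AlgHom.commutes]
      linear_combination (-ofTrace p * zeta n) * h

/-- The algebra of functions as the polynomials in `z` over the functions invariant under `e`. -/
def ofPolynomial : Polynomial InvariantModel →+* Functions :=
  Polynomial.eval₂RingHom ofLaurent z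

theorem ofPolynomial_C (l : InvariantModel) :
    ofPolynomial (Polynomial.C l) = ofLaurent l := by
  simp [ofPolynomial]

theorem ofPolynomial_X : ofPolynomial Polynomial.X = z := by
  simp [ofPolynomial]

theorem e_ofPolynomial (b : Polynomial InvariantModel) :
    dE (ofPolynomial b) = ofPolynomial (Polynomial.derivative b) := by
  induction b using Polynomial.induction_on' with
  | add p q hp hq => simp only [map_add, hp, hq]
  | monomial n l =>
    rw [Polynomial.derivative_monomial, ← Polynomial.C_mul_X_pow_eq_monomial,
      ← Polynomial.C_mul_X_pow_eq_monomial, map_mul ofPolynomial, map_mul ofPolynomial,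
      map_pow ofPolynomial, map_pow ofPolynomial, ofPolynomial_C, ofPolynomial_C, ofPolynomial_X,
      Derivation.leibniz, e_ofLaurent, Derivation.leibniz_pow, e_z, map_mul ofLaurent,
      map_natCast ofLaurent]
    simp
    ring

/-- The image of `ζ` in the polynomial model. -/
def zetaModel : (Polynomial InvariantModel)ˣ where
  val := Polynomial.C (LaurentPolynomial.T 1)
  inv := Polynomial.C (LaurentPolynomial.T (-1))
  val_inv := by rw [← map_mul, ← LaurentPolynomial.T_add, add_neg_cancel,
    LaurentPolynomial.T_zero, map_one]
  inv_val := by rw [← map_mul, ← LaurentPolynomial.T_add, neg_add_cancel,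
    LaurentPolynomial.T_zero, map_one]

theorem zetaModel_zpow (n : ℤ) : ((zetaModel ^ n : (Polynomial InvariantModel)ˣ) :
    Polynomial InvariantModel) = Polynomial.C (LaurentPolynomial.T n) := by
  rcases Int.eq_nat_or_neg n with ⟨m, rfl | rfl⟩
  · rw [zpow_natCast, Units.val_pow_eq_pow_val]
    change Polynomial.C (LaurentPolynomial.T 1) ^ m = _
    rw [← map_pow, LaurentPolynomial.T_pow, mul_one]
  · rw [zpow_neg, zpow_natCast, ← inv_pow, Units.val_pow_eq_pow_val]
    change Polynomial.C (LaurentPolynomial.T (-1)) ^ m = _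
    rw [← map_pow, LaurentPolynomial.T_pow, mul_neg_one]

/-- The image of the trace function in the polynomial model. -/
def traceModel : Polynomial InvariantModel :=
  Polynomial.C (LaurentPolynomial.C Polynomial.X)

/-- The image of `(x + y) / 2` in the polynomial model. -/
def meanModel : Polynomial InvariantModel :=
  algebraMap ℂ (Polynomial InvariantModel) (1 / 2) *
    (traceModel * Polynomial.C (LaurentPolynomial.T (-1)))

/-- The coordinates in terms of the trace, `ζ` and `z`. -/
def toPolynomial : Functions →+* Polynomial InvariantModel :=
  LaurentPolynomial.eval₂
    (MvPolynomial.eval₂Hom (algebraMap ℂ (Polynomial InvariantModel))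
      ![meanModel - Polynomial.X, meanModel + Polynomial.X]) zetaModel

theorem toPolynomial_zeta (n : ℤ) :
    toPolynomial (zeta n) = Polynomial.C (LaurentPolynomial.T n) := by
  rw [toPolynomial, zeta, LaurentPolynomial.eval₂_T, zetaModel_zpow]

theorem toPolynomial_x : toPolynomial x = meanModel - Polynomial.X := by
  rw [toPolynomial, x, LaurentPolynomial.eval₂_C]
  simp

theorem toPolynomial_y : toPolynomial y = meanModel + Polynomial.X := by
  rw [toPolynomial, y, LaurentPolynomial.eval₂_C]
  simp

theorem toPolynomial_algebraMap (c : ℂ) :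
    toPolynomial (algebraMap ℂ Functions c) = algebraMap ℂ (Polynomial InvariantModel) c := by
  have h : algebraMap ℂ Functions c = LaurentPolynomial.C (MvPolynomial.C c) := rfl
  rw [h, toPolynomial, LaurentPolynomial.eval₂_C, MvPolynomial.coe_eval₂Hom,
    MvPolynomial.eval₂_C]

theorem two_mul_algebraMap_half :
    2 * algebraMap ℂ (Polynomial InvariantModel) (1 / 2) = 1 := by
  rw [← map_ofNat (algebraMap ℂ (Polynomial InvariantModel)) 2, ← map_mul]
  norm_num

theorem mul_sub_eq_of_two_mul {R : Type*} [CommRing R] {a b c : R} (h : 2 * a = 1) :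
    a * (b + c - (b - c)) = c := by
  linear_combination c * h

theorem mul_add_eq_of_two_mul {R : Type*} [CommRing R] {a b c t u : R} (h : 2 * a = 1)
    (hu : u * c = 1) : u * (a * (t * c) - b + (a * (t * c) + b)) = t := by
  linear_combination t * u * c * h + t * hu

theorem toPolynomial_z : toPolynomial z = Polynomial.X := by
  rw [z, map_mul, half, toPolynomial_algebraMap, map_sub, toPolynomial_x, toPolynomial_y]
  exact mul_sub_eq_of_two_mul (R := Polynomial InvariantModel) two_mul_algebraMap_half

theorem toPolynomial_trace : toPolynomial trace = traceModel := by
  rw [trace, map_mul, map_add, toPolynomial_x, toPolynomial_y, toPolynomial_zeta, meanModel]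
  exact mul_add_eq_of_two_mul (R := Polynomial InvariantModel) two_mul_algebraMap_half
    zetaModel.val_inv

theorem toPolynomial_ofTrace (p : Polynomial ℂ) :
    toPolynomial (ofTrace p) = Polynomial.C (LaurentPolynomial.C p) := by
  induction p using Polynomial.induction_on' with
  | add p q hp hq => simp only [map_add, hp, hq]
  | monomial n c =>
    rw [← Polynomial.C_mul_X_pow_eq_monomial, map_mul, map_mul, map_pow, map_pow, ofTrace,
      Polynomial.aeval_C, Polynomial.aeval_X, toPolynomial_trace, toPolynomial_algebraMap,
      map_mul, map_mul, map_pow, map_pow]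
    rfl

theorem toPolynomial_ofLaurent (l : InvariantModel) :
    toPolynomial (ofLaurent l) = Polynomial.C l := by
  induction l using LaurentPolynomial.induction_on' with
  | add p q hp hq => simp only [map_add, hp, hq]
  | C_mul_T n p =>
    rw [ofLaurent_C_mul_T, map_mul, toPolynomial_ofTrace, toPolynomial_zeta, map_mul]

theorem toPolynomial_ofPolynomial (b : Polynomial InvariantModel) :
    toPolynomial (ofPolynomial b) = b := by
  induction b using Polynomial.induction_on' with
  | add p q hp hq => simp only [map_add, hp, hq]
  | monomial n l =>
    rw [← Polynomial.C_mul_X_pow_eq_monomial, map_mul, map_mul, map_pow, map_pow, ofPolynomial_C,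
      ofPolynomial_X, toPolynomial_ofLaurent, toPolynomial_z]

theorem zeta_neg_one_mul_trace : zeta (-1) * trace = x + y := by
  have h : zeta (-1) * zeta 1 = 1 := zetaUnit.inv_val
  rw [trace]
  linear_combination (x + y) * h

theorem ofPolynomial_surjective : Function.Surjective ofPolynomial := by
  intro a
  change a ∈ ofPolynomial.rangeS
  have hC (c : ℂ) : algebraMap ℂ Functions c ∈ ofPolynomial.rangeS :=
    ⟨Polynomial.C (LaurentPolynomial.C (Polynomial.C c)), by
      rw [ofPolynomial_C, ofLaurent_C, ofTrace, Polynomial.aeval_C]⟩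
  have hzeta (n : ℤ) : zeta n ∈ ofPolynomial.rangeS :=
    ⟨Polynomial.C (LaurentPolynomial.T n), by rw [ofPolynomial_C, ofLaurent_T]⟩
  have hz : z ∈ ofPolynomial.rangeS := ⟨Polynomial.X, ofPolynomial_X⟩
  have ht : trace ∈ ofPolynomial.rangeS :=
    ⟨Polynomial.C (LaurentPolynomial.C Polynomial.X), by
      rw [ofPolynomial_C, ofLaurent_C, ofTrace, Polynomial.aeval_X]⟩
  have hmean : half * (zeta (-1) * trace) ∈ ofPolynomial.rangeS :=
    mul_mem (hC _) (mul_mem (hzeta _) ht)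
  induction a using functions_induction with
  | hC c => exact hC c
  | hx =>
    have h : x = half * (zeta (-1) * trace) + algebraMap ℂ Functions (-1) * z := by
      rw [zeta_neg_one_mul_trace, z, map_neg, map_one]
      linear_combination -x * two_mul_half
    rw [h]
    exact add_mem hmean (mul_mem (hC _) hz)
  | hy =>
    have h : y = half * (zeta (-1) * trace) + z := by
      rw [zeta_neg_one_mul_trace, z]
      linear_combination -y * two_mul_half
    rw [h]
    exact add_mem hmean hz
  | hz n => exact hzeta n
  | hadd p q hp hq => exact add_mem hp hq
  | hmul p q hp hq => exact mul_mem hp hq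

theorem eq_C_of_derivative_eq_zero {R : Type*} [CommRing R] [Algebra ℂ R] {b : Polynomial R}
    (h : Polynomial.derivative b = 0) : b = Polynomial.C (b.coeff 0) := by
  have : Module ℚ R := Module.compHom R (algebraMap ℚ ℂ)
  have : IsAddTorsionFree R := .of_module_rat R
  exact Polynomial.eq_C_of_natDegree_eq_zero (Polynomial.derivative_eq_zero.1 h)

theorem exists_ofLaurent_of_e_eq_zero {k : Functions} (h : dE k = 0) :
    ∃ l, k = ofLaurent l := by
  obtain ⟨b, rfl⟩ := ofPolynomial_surjective k
  rw [e_ofPolynomial] at h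
  have h' := congrArg toPolynomial h
  rw [toPolynomial_ofPolynomial, map_zero] at h'
  refine ⟨b.coeff 0, ?_⟩
  rw [← ofPolynomial_C]
  exact congrArg ofPolynomial (eq_C_of_derivative_eq_zero h')

theorem e_surjective (a : Functions) : ∃ c, dE c = a := by
  obtain ⟨b, rfl⟩ := ofPolynomial_surjective a
  induction b using Polynomial.induction_on' with
  | add p q hp hq =>
    obtain ⟨c, hc⟩ := hp
    obtain ⟨d, hd⟩ := hq
    exact ⟨c + d, by rw [map_add, hc, hd, map_add]⟩
  | monomial n l =>
    have hn : (n + 1 : ℂ) ≠ 0 := Nat.cast_add_one_ne_zero n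
    have h : algebraMap ℂ Functions (1 / (n + 1)) * (n + 1) = 1 := by
      rw [← map_natCast (algebraMap ℂ Functions), ← map_one (algebraMap ℂ Functions), ← map_add,
        ← map_mul, one_div_mul_cancel hn]
    refine ⟨algebraMap ℂ Functions (1 / (n + 1)) * ofPolynomial (Polynomial.monomial (n + 1) l),
      ?_⟩
    rw [Derivation.leibniz, Derivation.map_algebraMap, smul_zero, add_zero, e_ofPolynomial,
      Polynomial.derivative_monomial_succ, ← Polynomial.C_mul_X_pow_eq_monomial,
      ← Polynomial.C_mul_X_pow_eq_monomial, map_mul ofPolynomial, map_mul ofPolynomial,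
      ofPolynomial_C, ofPolynomial_C, map_mul ofLaurent, map_add ofLaurent, map_natCast ofLaurent,
      map_one ofLaurent, smul_eq_mul]
    linear_combination (ofLaurent l * ofPolynomial (Polynomial.X ^ n)) * h

theorem of_h_eq_ofTrace {k : Functions} {p : Polynomial ℂ} (hk : dE k = 0)
    (h : dH k = ofTrace p) : p = 0 ∧ ∃ q, k = ofTrace q := by
  obtain ⟨l, rfl⟩ := exists_ofLaurent_of_e_eq_zero hk
  obtain ⟨m, hm, hlm⟩ := exists_h_ofLaurent l
  rw [hm, ← ofLaurent_C] at h
  have h' := congrArg toPolynomial h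
  rw [toPolynomial_ofLaurent, toPolynomial_ofLaurent] at h'
  obtain rfl := Polynomial.C_injective h'
  constructor
  · have h0 := hlm 0
    rwa [LaurentPolynomial.C_apply, if_pos rfl, Int.cast_zero, mul_zero, zero_mul] at h0
  · refine ⟨l.coeff 0, ?_⟩
    rw [← ofLaurent_C]
    congr 1
    ext1 n
    rw [LaurentPolynomial.C_apply]
    split_ifs with hn
    · rw [hn]
    · have h1 := hlm n
      rw [LaurentPolynomial.C_apply, if_neg hn] at h1
      simpa [hn] using h1.symm

theorem ofTrace_injective : Function.Injective ofTrace := by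
  intro p q h
  have h' := congrArg toPolynomial h
  rw [toPolynomial_ofTrace, toPolynomial_ofTrace] at h'
  have h2 := congrArg (fun l : InvariantModel => l.coeff 0) (Polynomial.C_injective h')
  simpa using h2

/-- The big cell as a family of free orbits of the Borel subalgebra, parametrized by the trace. -/
def trivialization : Trivialization diagonalAction where
  const := ofTrace.comp WeylInvariants.equivPolynomial.toAlgHom
  z := z
  u := zeta 1
  v := zeta (-1)
  const_injective := ofTrace_injective.comp WeylInvariants.equivPolynomial.injective
  u_mul_v := zetaUnit.val_inv
  e_z := e_z
  h_z := h_z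
  e_u := e_zeta 1
  h_u := by rw [h_zeta, Int.cast_one, mul_one]
  e_v := e_zeta (-1)
  h_v := by rw [h_zeta]; push_cast; ring
  e_const _ := derivation_ofTrace _ e_trace _
  h_const _ := derivation_ofTrace _ h_trace _
  f_of_e k hk := by
    obtain ⟨l, rfl⟩ := exists_ofLaurent_of_e_eq_zero hk
    exact f_ofLaurent l
  e_surjective := e_surjective
  exists_const_add k hk := by
    obtain ⟨l, rfl⟩ := exists_ofLaurent_of_e_eq_zero hk
    obtain ⟨p, m, h⟩ := exists_ofTrace_add l
    refine ⟨WeylInvariants.equivPolynomial.symm p, ofLaurent m, e_ofLaurent m, ?_⟩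
    rw [h]
    congr 1
    exact (congrArg ofTrace (WeylInvariants.equivPolynomial.apply_symm_apply p)).symm
  of_h_eq_const k r hk h := by
    obtain ⟨h1, q, rfl⟩ := of_h_eq_ofTrace hk h
    refine ⟨(map_eq_zero_iff _ WeylInvariants.equivPolynomial.injective).1 h1,
      WeylInvariants.equivPolynomial.symm q, ?_⟩
    exact congrArg ofTrace (WeylInvariants.equivPolynomial.apply_symm_apply q).symm

end Action

theorem exists_mem_cohomologyDeg_one_ne_zero :
    ∃ c ∈ LieCohomology.cohomologyDeg basis diagonalAction 1, c ≠ 0 := by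
  rw [← trivialization.map_toCohomology]
  refine ⟨_, ⟨1 ⊗ₜ Target.gen 0 + 0 ⊗ₜ Target.gen 1,
    Target.mem_targetDeg_one.2 ⟨1, 0, rfl⟩, rfl⟩, fun h => ?_⟩
  have h0 := (map_eq_zero_iff _ trivialization.toCohomology_injective).1 h
  have h1 := trivialization.coe_targetCocycle_one 1 0
  rw [h0, map_zero] at h1
  have h2 := trivialization.eq_zero_of_coboundary (u := 0) (r := 0) (s := 1) (t := 0) (w := 0)
    (by rw [← h1]; simp [cochain0_zero, cochain2_zero])
  exact one_ne_zero h2.2.1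

end BigCell

theorem eq_zero_of_equiv_tensorProduct {P M N : Type*} [AddCommMonoid P]
    [Module ℂ P] [AddCommMonoid M] [Module ℂ M] [AddCommMonoid N] [Module ℂ N] (h : ∀ b : N, b = 0)
    (e : P ≃ₗ[ℂ] M ⊗[ℂ] N) (p : P) : p = 0 := by
  have h0 (t : M ⊗[ℂ] N) : t = 0 := by
    induction t using TensorProduct.induction_on with
    | zero => rfl
    | add a b ha hb => rw [ha, hb, add_zero]
    | tmul a b => rw [h b, TensorProduct.tmul_zero]
  exact e.injective ((h0 (e p)).trans (map_zero e).symm)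

end

theorem mainTheorem7 :
    (∃ Φ : LieCohomology.Cohomology SL2.basis BigCell.diagonalAction ≃ₐ[ℂ] Target,
      ∀ n : ℕ, (LieCohomology.cohomologyDeg SL2.basis BigCell.diagonalAction n).map
        Φ.toLinearMap = targetDeg n) ∧
    ¬ (∀ n : ℕ, Nonempty
        (LieCohomology.cohomologyDeg SL2.basis BigCell.diagonalAction n ≃ₗ[ℂ]
          LieCohomology.invariants BigCell.diagonalAction ⊗[ℂ]
            LieCohomology.cohomologyDeg SL2.basis
              (0 : SL2 →ₗ⁅ℂ⁆ Derivation ℂ ℂ ℂ) n)) := by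
  refine ⟨⟨_, BigCell.trivialization.map_cohomologyEquiv⟩, fun h => ?_⟩
  obtain ⟨e⟩ := h 1
  obtain ⟨c, hc, hc0⟩ := BigCell.exists_mem_cohomologyDeg_one_ne_zero
  have h0 (b : LieCohomology.cohomologyDeg SL2.basis (0 : SL2 →ₗ⁅ℂ⁆ Derivation ℂ ℂ ℂ) 1) :
      b = 0 := Subtype.ext ((Submodule.eq_bot_iff _).1 SL2.cohomologyDeg_one_trivial b b.2)
  exact hc0 (congrArg Subtype.val (eq_zero_of_equiv_tensorProduct h0 e ⟨c, hc⟩))
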